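/- **Setting.** A *symmetric channel* is a mixture of binary symmetric channels: it is given by a probability law $\nu$ on $[0,1/2]$, and when $x\in\mathbb F_2^n$ is sent, the output is $Y=(Y_1,\dots,Y_n)$ with $Y_i=(\epsilon_i,x_i\oplus w_i)$, where the pairs $(\epsilon_i,w_i)$ are i.i.d., $\epsilon_i\sim\nu$ and $w_i\sim\mathrm{Ber}(\epsilon_i)$ given $\epsilon_i$. Its capacity $C$, in bits per channel use, is the supremum over input laws of the mutual information between one input bit and its output. A binary linear code $\mathcal C\subseteq\mathbb F_2^n$ has rate $R=\dim(\mathcal C)/n$, and its restriction to $P\subseteq[n]$ has rate $\dim(\mathcal C|_P)/|P|$; its symmetry group consists of the permutations of $[n]$ that preserve $\mathcal C$. The code is a *camellia code of expansion $\delta$ and correlation $\rho$* if its symmetry group is transitive on $[n]$ and there is a collection of subsets of $[n]$ (the petals), such that every coordinate lies in some petal, and (i) the collection is invariant under the symmetry group; (ii) the restriction of the code to any petal has rate at most $R+\delta$; (iii) for all coordinates $i\ne j$ and a uniformly drawn petal $P$, $\mathbb P(j\in P\mid i\in P)\le\rho$. For $i\in[n]$ and $S\subseteq[n]$, a *maximum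 likelihood (ML) decoder* of $X_i$ from $Y_S=(Y_j)_{j\in S}$ is a measurable rule returning, for each value of $Y_S$, a bit $b$ that maximizes the likelihood of that value given $X_i=b$, for a uniformly drawn codeword $X$ (ties are broken arbitrarily; a bit that no codeword has at $i$ has likelihood $0$). For a transmitted codeword $X$ let $P_{\mathrm{loc}}=\max_{i}\mathbb P(\hat X_i(Y_{-i})\ne X_i)$ and $P_{\mathrm{bit}}=\max_i\mathbb P(\hat X_i(Y)\ne X_i)$, where $\hat X_i(Y_{-i})$ and $\hat X_i(Y)$ are ML decoders of $X_i$ from $(Y_j)_{j\ne i}$ and from $Y$ respectively. **Theorem 1.** Fix a symmetric channel of capacity $C$, and let $(\mathcal C_k)_{k\ge 0}$ be a sequence of camellia codes of rates $R_k$, expansions $\delta_k$ and correlations $\rho_k$. Suppose that there is $\gamma>0$ with $\delta_k\le C-R_k-\gamma$ for all sufficiently large $k$, and that $\rho_k\to0$. Then, for every choice of transmitted codewords $x_k\in\mathcal C_k$ and of ML decoders, $$P_{\mathrm{loc}}(\mathcal C_k)=O(\sqrt{\rho_k})\quad(k\to\infty),\qquad P_{\mathrm{loc}}(\mathcal C_k)\to0,\qquad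 P_{\mathrm{bit}}(\mathcal C_k)\to0 .$$ -/

import Mathlib

open MeasureTheory Filter Topology Asymptotics

noncomputable section

/-- Crossover probabilities `ε ∈ [0, 1/2]` of binary symmetric channels. -/
abbrev Crossover : Type := Set.Icc (0 : ℝ) (1 / 2)

/-- Output letters `(ε, X ⊕ w)` of a symmetric channel. -/
abbrev OutputLetter : Type := Crossover × ZMod 2

/-- The `Ber(ε)` probability of the noise bit `w`. -/
def flipProb (ε : Crossover) (w : ZMod 2) : ℝ :=
  if w = 0 then 1 - (ε : ℝ) else (ε : ℝ)

/-- A symmetric channel is given by the law `ν` of the crossover probability.  This is the law of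
`(ε, w)` with `ε ∼ ν` and, given `ε`, `w ∼ Ber(ε)`. -/
def noiseLaw (ν : Measure Crossover) : Measure OutputLetter :=
  (ν.prod Measure.count).withDensity fun z => ENNReal.ofReal (flipProb z.1 z.2)

/-- The law of the output letter `(ε, b ⊕ w)` when the bit `b` is sent. -/
def outputLaw (ν : Measure Crossover) (b : ZMod 2) : Measure OutputLetter :=
  (noiseLaw ν).map fun z => (z.1, b + z.2)

/-- The law of the output word when the word `x` is sent (independent uses of the channel). -/
def wordLaw (ν : Measure Crossover) {n : ℕ} (x : Fin n → ZMod 2) :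
    Measure (Fin n → OutputLetter) :=
  Measure.pi fun j => outputLaw ν (x j)

/-- The joint law of input bit and output letter when the input has law `μ`. -/
def jointLaw (ν : Measure Crossover) (μ : Measure (ZMod 2)) : Measure (ZMod 2 × OutputLetter) :=
  ∑ b : ZMod 2, μ {b} • (Measure.dirac b).prod (outputLaw ν b)

/-- The mutual information, in nats, between input and output when the input has law `μ`:
the divergence of the joint law from the product of its two marginals. -/
def mutualInfo (ν : Measure Crossover) (μ : Measure (ZMod 2)) : ENNReal :=
  InformationTheory.klDiv (jointLaw ν μ)
    ((jointLaw ν μ).fst.prod (jointLaw ν μ).snd)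

/-- The capacity, in bits per channel use: the supremum of the mutual information over all
input laws. -/
def capacity (ν : Measure Crossover) : ℝ :=
  (⨆ μ : ProbabilityMeasure (ZMod 2), mutualInfo ν μ).toReal / Real.log 2

/-- Binary linear codes of length `n`. -/
abbrev BinaryCode (n : ℕ) : Type := Submodule (ZMod 2) (Fin n → ZMod 2)

/-- The rate of a binary linear code. -/
def codeRate {n : ℕ} (C : BinaryCode n) : ℝ :=
  (Module.finrank (ZMod 2) C : ℝ) / n

/-- The restriction of a code to a set of coordinates. -/
def codeRestrict {n : ℕ} (C : BinaryCode n) (P : Finset (Fin n)) :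
    Submodule (ZMod 2) (P → ZMod 2) :=
  C.map (LinearMap.funLeft (ZMod 2) (ZMod 2) (Subtype.val : P → Fin n))

/-- The rate of the restriction of a code to a set of coordinates. -/
def restrictRate {n : ℕ} (C : BinaryCode n) (P : Finset (Fin n)) : ℝ :=
  (Module.finrank (ZMod 2) (codeRestrict C P) : ℝ) / P.card

/-- The coordinate permutations that preserve the code (its symmetry group). -/
def IsCodeSymmetry {n : ℕ} (C : BinaryCode n) (σ : Equiv.Perm (Fin n)) : Prop :=
  ∀ x : Fin n → ZMod 2, x ∘ σ ∈ C ↔ x ∈ C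

/-- Camellia codes of expansion `δ` and correlation `ρ`.  The first condition on the petals says
that the conditional probabilities `ℙ(j ∈ P | i ∈ P)` in the last one are well defined. -/
structure IsCamelliaCode {n : ℕ} (C : BinaryCode n) (δ ρ : ℝ) : Prop where
  transitive : ∀ i j : Fin n, ∃ σ, IsCodeSymmetry C σ ∧ σ i = j
  petals : ∃ petals : Finset (Finset (Fin n)),
    (∀ i, ∃ P ∈ petals, i ∈ P) ∧
    (∀ P ∈ petals, ∀ σ, IsCodeSymmetry C σ → P.map σ.toEmbedding ∈ petals) ∧
    (∀ P ∈ petals, restrictRate C P ≤ codeRate C + δ) ∧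
    ∀ i j : Fin n, i ≠ j →
      ((petals.filter fun P => i ∈ P ∧ j ∈ P).card : ℝ) / (petals.filter fun P => i ∈ P).card ≤ ρ

/-- Rules that decide on one bit from the outputs on the set `S` of coordinates. -/
abbrev BitDecoder {n : ℕ} (S : Finset (Fin n)) : Type := (S → OutputLetter) → ZMod 2

open Classical in
/-- The likelihood of the bit value `b` at coordinate `i`, given the outputs `y` on the set `S` of
coordinates: the conditional density of `Y_S` at `y` given `X_i = b` (with respect to the product of
the crossover laws and counting measures), for a uniformly drawn codeword `X`.  It is `0`
if no codeword has `b` at coordinate `i`. -/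
def bitLikelihood {n : ℕ} (C : BinaryCode n) (i : Fin n) (S : Finset (Fin n))
    (y : S → OutputLetter) (b : ZMod 2) : ℝ :=
  (∑ x : Fin n → ZMod 2 with x ∈ C ∧ x i = b, ∏ j : S, flipProb (y j).1 ((y j).2 - x j)) /
    (Finset.univ.filter fun x : Fin n → ZMod 2 => x ∈ C ∧ x i = b).card

/-- `D` is a maximum likelihood decoder of coordinate `i` from the outputs on `S`; ties may be
broken in any (measurable) way. -/
structure IsMLDecoder {n : ℕ} (C : BinaryCode n) (i : Fin n) (S : Finset (Fin n))
    (D : BitDecoder S) : Prop where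
  measurable : Measurable D
  maximal : ∀ y b, bitLikelihood C i S y b ≤ bitLikelihood C i S y (D y)

/-- The probability that `D`, applied to the outputs on `S`, does not return the bit `x i` when the
word `x` is sent. -/
def decodingError (ν : Measure Crossover) {n : ℕ} (x : Fin n → ZMod 2) (i : Fin n)
    (S : Finset (Fin n)) (D : BitDecoder S) : ℝ :=
  (wordLaw ν x).real {y | D (fun j => y j) ≠ x i}

/-- The local error probability: the largest probability of a wrong decision on a bit from the
outputs at all other coordinates. -/
def localError (ν : Measure Crossover) {n : ℕ} (x : Fin n → ZMod 2)
    (D : ∀ i : Fin n, BitDecoder ({i}ᶜ : Finset (Fin n))) : ℝ :=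
  ⨆ i, decodingError ν x i {i}ᶜ (D i)

/-- The bit-error probability: the largest probability of a wrong decision on a bit from all
outputs. -/
def bitError (ν : Measure Crossover) {n : ℕ} (x : Fin n → ZMod 2)
    (D : Fin n → BitDecoder (Finset.univ : Finset (Fin n))) : ℝ :=
  ⨆ i, decodingError ν x i Finset.univ (D i)

end

/-! Densities are taken relative to the base law, under which the output letters are independent
with fair output bits. Given the input bit b, a letter has density 1 + (-1)^b u, where u = `softBit`
has base mean zero. For a uniform codeword X, let g be the conditional mean of (-1)^(X_i) given the
outputs on S (`softDecision`). Its second moment, `decisionEnergy`, measures how much S knows about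
bit i.

Entropy makes the energy large. On a petal P, the divergence of the outputs from the base law is at
least |P| I - dim(C|_P) log 2 (`le_blockInfo`), where I is the information of a fair input, itself
at least the capacity in nats (`capacity_mul_log_two_le`). Revealing the letters of P one at a time,
each new letter i adds at most the energy of bit i given the letters already seen
(`blockInfo_insert_le`, from log(1+t) ≤ t), and energy grows with the observed set
(`decisionEnergy_mono`). So the energies of the bits i of P, each seen from P \ {i}, sum to at least
|P| γ log 2. Transitivity and the invariance of the petals turn this average over coordinates into a
bound at every coordinate (`le_sum_decisionEnergy`).

Now let all d petals through i vote, by adding their soft decisions. The vote is equivariant under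
addition of codewords, so it may be studied for the zero codeword, where the letters are independent
and the mean of a soft decision equals its energy (`integral_softDecision`). The vote thus has mean
at least d γ log 2. A coordinate other than i enters at most ρ d of the summands, so the variance is
at most ρ d² (`variance_sum_le`). By Chebyshev's inequality the vote has the wrong sign with
probability at most ρ/(γ log 2)².

Finally, a maximum likelihood decoder errs at most twice as often as the sign of the vote
(`decodingError_le`). The vote ignores the output at i, so both error probabilities are covered. The
resulting bound is linear in ρ, which is stronger than the stated √ρ. -/

noncomputable section

/-! ### Single letters: soft bits, base law and channel symmetry. -/

/-- The real character `b ↦ (-1)^b` of `ZMod 2`. -/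
def bitSign (b : ZMod 2) : ℝ := if b = 0 then 1 else -1

lemma bitSign_zero : bitSign 0 = 1 := by simp [bitSign]

lemma bitSign_one : bitSign 1 = -1 := by simp [bitSign]

lemma zmod_two_cases (b : ZMod 2) : b = 0 ∨ b = 1 := by
  revert b; decide

lemma bitSign_add (a b : ZMod 2) : bitSign (a + b) = bitSign a * bitSign b := by
  have h : (1 : ZMod 2) + 1 = 0 := by decide
  rcases zmod_two_cases a with rfl | rfl <;> rcases zmod_two_cases b with rfl | rfl <;>
    simp [bitSign_zero, bitSign_one, h]

lemma bitSign_mul_self (a : ZMod 2) : bitSign a * bitSign a = 1 := by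
  rcases zmod_two_cases a with rfl | rfl <;> simp [bitSign_zero, bitSign_one]

lemma abs_bitSign (a : ZMod 2) : |bitSign a| = 1 := by
  rcases zmod_two_cases a with rfl | rfl <;> simp [bitSign_zero, bitSign_one]

/-- The correlation of an output letter with the bit `0`. -/
def softBit (z : OutputLetter) : ℝ := bitSign z.2 * (1 - 2 * (z.1 : ℝ))

lemma abs_softBit_le (z : OutputLetter) : |softBit z| ≤ 1 := by
  rw [softBit, abs_mul, abs_bitSign, one_mul, abs_le]
  have h := z.1.2
  constructor <;> linarith [h.1, h.2]

lemma measurable_bitSign : Measurable bitSign := .of_discrete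

lemma measurable_softBit : Measurable softBit := by
  unfold softBit
  exact (measurable_bitSign.comp measurable_snd).mul
    (measurable_const.sub (measurable_const.mul (measurable_subtype_coe.comp measurable_fst)))

lemma flipProb_sub (z : OutputLetter) (b : ZMod 2) :
    flipProb z.1 (z.2 - b) = (1 + bitSign b * softBit z) / 2 := by
  obtain ⟨ε, w⟩ := z
  have h : (0 : ZMod 2) - 1 = 1 := by decide
  rcases zmod_two_cases b with rfl | rfl <;> rcases zmod_two_cases w with rfl | rfl <;>
    simp [softBit, flipProb, bitSign_zero, bitSign_one, h] <;> ring

/-- The letter density with respect to the base law is nonnegative. -/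
lemma letterDensity_nonneg (b : ZMod 2) (z : OutputLetter) : 0 ≤ 1 + bitSign b * softBit z := by
  have h : |bitSign b * softBit z| ≤ 1 := by
    rw [abs_mul, abs_bitSign, one_mul]; exact abs_softBit_le z
  linarith [neg_le_of_abs_le h]

lemma letterDensity_le_two (b : ZMod 2) (z : OutputLetter) : 1 + bitSign b * softBit z ≤ 2 := by
  have h : |bitSign b * softBit z| ≤ 1 := by
    rw [abs_mul, abs_bitSign, one_mul]; exact abs_softBit_le z
  linarith [le_of_abs_le h]

lemma measurable_letterDensity (b : ZMod 2) :
    Measurable fun z : OutputLetter => 1 + bitSign b * softBit z :=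
  measurable_const.add (measurable_const.mul measurable_softBit)

/-- The law of a fair bit. -/
def fairBit : Measure (ZMod 2) := (2 : ENNReal)⁻¹ • Measure.count

instance : IsProbabilityMeasure fairBit where
  measure_univ := by
    simp [fairBit, Measure.count_apply, ENat.card_eq_coe_fintype_card, ZMod.card,
      ENNReal.inv_mul_cancel]

lemma lintegral_fairBit (f : ZMod 2 → ENNReal) : ∫⁻ w, f w ∂fairBit = 2⁻¹ * (f 0 + f 1) := by
  rw [fairBit, lintegral_smul_measure, lintegral_count, tsum_fintype, smul_eq_mul]
  congr 1
  exact Fin.sum_univ_two f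

/-- The output law of the channel when the input bit is fair: the output bit is then a fair bit,
independent of the crossover probability. -/
def baseLaw (ν : Measure Crossover) : Measure OutputLetter := ν.prod fairBit

instance (ν : Measure Crossover) [IsProbabilityMeasure ν] : IsProbabilityMeasure (baseLaw ν) := by
  unfold baseLaw; infer_instance

/-- Addition of `b` to the bit of an output letter. -/
def letterShift (b : ZMod 2) (z : OutputLetter) : OutputLetter := (z.1, b + z.2)

lemma measurable_letterShift (b : ZMod 2) : Measurable (letterShift b) :=
  measurable_fst.prodMk
    ((Measurable.of_discrete (f := fun w : ZMod 2 => b + w)).comp measurable_snd)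

lemma softBit_letterShift (b : ZMod 2) (z : OutputLetter) :
    softBit (letterShift b z) = bitSign b * softBit z := by
  simp only [softBit, letterShift, bitSign_add, mul_assoc]

lemma letterShift_letterShift (b : ZMod 2) (z : OutputLetter) :
    letterShift b (letterShift b z) = z := by
  have h : b + b = 0 := by revert b; decide
  simp [letterShift, ← add_assoc, h]

lemma outputLaw_eq_withDensity (ν : Measure Crossover) (b : ZMod 2) : outputLaw ν b =
    (baseLaw ν).withDensity fun z => ENNReal.ofReal (1 + bitSign b * softBit z) := by
  have hflip : Measurable fun z : OutputLetter => ENNReal.ofReal (flipProb z.1 z.2) := by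
    have h : (fun z : OutputLetter => ENNReal.ofReal (flipProb z.1 z.2)) =
        fun z => ENNReal.ofReal ((1 + bitSign 0 * softBit z) / 2) := by
      funext z; rw [← flipProb_sub, sub_zero]
    rw [h]
    exact ((measurable_letterDensity 0).div_const 2).ennreal_ofReal
  refine Measure.ext_of_lintegral _ fun f hf => ?_
  have hfs : Measurable fun z => f (letterShift b z) := hf.comp (measurable_letterShift b)
  have hout : outputLaw ν b = (noiseLaw ν).map (letterShift b) := rfl
  rw [hout, lintegral_map hf (measurable_letterShift b), noiseLaw,
    lintegral_withDensity_eq_lintegral_mul _ hflip hfs,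
    lintegral_withDensity_eq_lintegral_mul _ (measurable_letterDensity b).ennreal_ofReal hf,
    baseLaw, lintegral_prod _ (hflip.mul hfs).aemeasurable,
    lintegral_prod _ ((measurable_letterDensity b).ennreal_ofReal.mul hf).aemeasurable]
  refine lintegral_congr fun ε => ?_
  rw [lintegral_fairBit, lintegral_count, tsum_fintype]
  -- The factor 2 compensates for the mass 1/2 that `fairBit` gives to each bit, against counting
  -- measure in `noiseLaw`.
  have key : ∀ w, ENNReal.ofReal (1 + bitSign b * softBit (ε, w)) =
      2 * ENNReal.ofReal (flipProb ε (w - b)) := by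
    intro w
    have h : (2 : ENNReal) = ENNReal.ofReal 2 := by simp
    rw [flipProb_sub (ε, w) b, h, ← ENNReal.ofReal_mul (by norm_num)]
    congr 1; ring
  have h1 : (1 : ZMod 2) + 1 = 0 := by decide
  have h2 : (0 : ZMod 2) - 1 = 1 := by decide
  simp only [Pi.mul_apply, key]
  rw [mul_assoc, mul_assoc, ← mul_add, ← mul_assoc,
    ENNReal.inv_mul_cancel (by norm_num) (by norm_num), one_mul]
  refine (Fin.sum_univ_two _).trans ?_
  change ENNReal.ofReal (flipProb ε 0) * f (ε, b + 0) + ENNReal.ofReal (flipProb ε 1) * f (ε, b + 1)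
    = _
  rcases zmod_two_cases b with rfl | rfl
  · simp
  · simp [h1, h2, add_comm]

lemma measurePreserving_letterShift (ν : Measure Crossover) (b : ZMod 2) :
    MeasurePreserving (letterShift b) (baseLaw ν) (baseLaw ν) := by
  refine ⟨measurable_letterShift b, Measure.ext_of_lintegral _ fun f hf => ?_⟩
  have hfs : Measurable fun z => f (letterShift b z) := hf.comp (measurable_letterShift b)
  rw [lintegral_map hf (measurable_letterShift b), baseLaw, lintegral_prod _ hf.aemeasurable,
    lintegral_prod _ hfs.aemeasurable]
  refine lintegral_congr fun ε => ?_
  rw [lintegral_fairBit, lintegral_fairBit]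
  have h1 : (1 : ZMod 2) + 1 = 0 := by decide
  rcases zmod_two_cases b with rfl | rfl <;> simp [letterShift, h1, add_comm]

/-- The shift is a measurable involution, so the change of variables needs no measurability or
integrability of `F`. -/
lemma integral_comp_letterShift (ν : Measure Crossover) (b : ZMod 2) (F : OutputLetter → ℝ) :
    ∫ z, F (letterShift b z) ∂baseLaw ν = ∫ z, F z ∂baseLaw ν :=
  (measurePreserving_letterShift ν b).integral_comp'
    (f := MeasurableEquiv.mk ⟨letterShift b, letterShift b, letterShift_letterShift b,
      letterShift_letterShift b⟩ (measurable_letterShift b) (measurable_letterShift b)) F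

lemma integral_softBit (ν : Measure Crossover) : ∫ z, softBit z ∂baseLaw ν = 0 := by
  have h := integral_comp_letterShift ν 1 softBit
  simp only [softBit_letterShift, bitSign_one, neg_mul, one_mul, integral_neg] at h
  linarith

/-- By symmetry of the channel, integrals of functions of the letter density do not depend on
the input bit. -/
lemma integral_comp_letterDensity (ν : Measure Crossover) (F : ℝ → ℝ) (b : ZMod 2) :
    ∫ z, F (1 + bitSign b * softBit z) ∂baseLaw ν = ∫ z, F (1 + softBit z) ∂baseLaw ν := by
  simpa only [softBit_letterShift] using
    integral_comp_letterShift ν b fun z => F (1 + softBit z)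

instance (ν : Measure Crossover) [IsProbabilityMeasure ν] (b : ZMod 2) :
    IsProbabilityMeasure (outputLaw ν b) where
  measure_univ := by
    rw [outputLaw_eq_withDensity, withDensity_apply _ MeasurableSet.univ, setLIntegral_univ,
      baseLaw, lintegral_prod _ (measurable_letterDensity b).ennreal_ofReal.aemeasurable]
    have : ∀ ε, ∫⁻ w, ENNReal.ofReal (1 + bitSign b * softBit (ε, w)) ∂fairBit = 1 := by
      intro ε
      rw [lintegral_fairBit, ← ENNReal.ofReal_add (letterDensity_nonneg _ _)
        (letterDensity_nonneg _ _)]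
      have : 1 + bitSign b * softBit (ε, 0) + (1 + bitSign b * softBit (ε, 1)) = 2 := by
        simp only [softBit, bitSign_zero, bitSign_one]; ring
      rw [this]
      simp [ENNReal.inv_mul_cancel]
    simp [this]

/-! ### Capacity is at most the information of a fair input. -/

open InformationTheory ProbabilityTheory in
/-- Replacing the second marginal by any other probability law can only increase the divergence
of a joint law from the product of its marginals. -/
lemma klDiv_prod_snd_le {α β : Type*} [MeasurableSpace α] [MeasurableSpace β]
    [StandardBorelSpace α] [Nonempty α] (J : Measure (α × β)) [IsProbabilityMeasure J]
    (q : Measure β) [IsProbabilityMeasure q] :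
    klDiv J (J.fst.prod J.snd) ≤ klDiv J (J.fst.prod q) := by
  set J' := J.map Prod.swap with hJ'
  have : IsProbabilityMeasure J' := Measure.isProbabilityMeasure_map measurable_swap.aemeasurable
  have hJ'fst : J'.fst = J.snd := Measure.fst_map_swap
  have hdis : J.snd ⊗ₘ J'.condKernel = J' := by
    rw [← hJ'fst]; exact J'.disintegrate J'.condKernel
  have hback : J'.map Prod.swap = J := by
    rw [hJ', Measure.map_map measurable_swap measurable_swap]
    simp
  -- The chain rule splits the divergence from the product with `q` into that of the marginal from
  -- `q`, plus the mutual information. It disintegrates along the first factor, hence the swaps.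
  have hchain := klDiv_compProd_eq_add (μ := J.snd) (ν := q) (κ := J'.condKernel)
    (η := ProbabilityTheory.Kernel.const β J.fst)
  rw [Measure.compProd_const, Measure.compProd_const, hdis] at hchain
  calc klDiv J (J.fst.prod J.snd)
      = klDiv (J'.map Prod.swap) ((J.snd.prod J.fst).map Prod.swap) := by
        rw [hback, Measure.prod_swap]
    _ ≤ klDiv J' (J.snd.prod J.fst) := klDiv_map_le _ _ measurable_swap
    _ ≤ klDiv J' (q.prod J.fst) := by rw [hchain]; exact le_add_self
    _ = klDiv J' ((J.fst.prod q).map Prod.swap) := by rw [Measure.prod_swap]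
    _ ≤ klDiv J (J.fst.prod q) := klDiv_map_le _ _ measurable_swap

section

variable (ν : Measure Crossover) [IsProbabilityMeasure ν]

/-- The mutual information, in nats, between a fair input bit and its output. -/
def fairInfo : ℝ := ∫ z, (1 + softBit z) * Real.log (1 + softBit z) ∂baseLaw ν

lemma jointLaw_eq_withDensity (μ : Measure (ZMod 2)) [IsProbabilityMeasure μ] : jointLaw ν μ =
    (μ.prod (baseLaw ν)).withDensity fun p => ENNReal.ofReal (1 + bitSign p.1 * softBit p.2) := by
  have hmeas : Measurable fun p : ZMod 2 × OutputLetter =>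
      ENNReal.ofReal (1 + bitSign p.1 * softBit p.2) :=
    (measurable_const.add ((measurable_bitSign.comp measurable_fst).mul
      (measurable_softBit.comp measurable_snd))).ennreal_ofReal
  refine Measure.ext_of_lintegral _ fun f hf => ?_
  rw [lintegral_withDensity_eq_lintegral_mul _ hmeas hf,
    lintegral_prod _ (hmeas.mul hf).aemeasurable,
    lintegral_fintype (α := ZMod 2), jointLaw, lintegral_finsetSum_measure]
  refine Finset.sum_congr rfl fun b _ => ?_
  have hfb : Measurable fun z => f (b, z) := hf.comp measurable_prodMk_left
  rw [lintegral_smul_measure, lintegral_prod _ hf.aemeasurable, lintegral_dirac,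
    outputLaw_eq_withDensity, lintegral_withDensity_eq_lintegral_mul _
      (measurable_letterDensity b).ennreal_ofReal hfb, smul_eq_mul,
    mul_comm]
  rfl

lemma fst_jointLaw (μ : Measure (ZMod 2)) [IsProbabilityMeasure μ] : (jointLaw ν μ).fst = μ := by
  ext s hs
  rw [Measure.fst_apply hs, jointLaw, Measure.finsetSum_apply]
  have : ∀ b, (μ {b} • (Measure.dirac b).prod (outputLaw ν b)) (Prod.fst ⁻¹' s) =
      Set.indicator s 1 b * μ {b} := by
    intro b
    rw [Measure.smul_apply, ← Set.prod_univ, Measure.prod_prod, measure_univ, mul_one,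
      Measure.dirac_apply' _ hs, smul_eq_mul, mul_comm]
  simp_rw [this]
  rw [← lintegral_fintype, lintegral_indicator_one hs]

instance (μ : Measure (ZMod 2)) [IsProbabilityMeasure μ] :
    IsProbabilityMeasure (jointLaw ν μ) where
  measure_univ := by
    rw [← Measure.fst_univ, fst_jointLaw, measure_univ]

lemma integrable_softBit : Integrable softBit (baseLaw ν) :=
  Integrable.of_bound measurable_softBit.aestronglyMeasurable 1
    (Eventually.of_forall abs_softBit_le)

lemma integrable_comp_letterDensity {F : ℝ → ℝ} (hF : Continuous F) (b : ZMod 2) :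
    Integrable (fun z => F (1 + bitSign b * softBit z)) (baseLaw ν) := by
  obtain ⟨B, hB⟩ := isCompact_Icc.exists_bound_of_continuousOn (s := Set.Icc (0 : ℝ) 2)
    hF.continuousOn
  exact Integrable.of_bound
    (hF.measurable.comp (measurable_letterDensity b)).aestronglyMeasurable B
    (Eventually.of_forall fun z => hB _ ⟨letterDensity_nonneg b z, letterDensity_le_two b z⟩)

-- Measured against the base law instead of the true output marginal, the conditional divergence
-- given the input bit is `fairInfo` for either bit, by channel symmetry. Averaging over any input
-- law leaves that value.
open InformationTheory in
lemma mutualInfo_le (μ : Measure (ZMod 2)) [IsProbabilityMeasure μ] :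
    mutualInfo ν μ ≤ ENNReal.ofReal (fairInfo ν) := by
  have hmeas : Measurable fun p : ZMod 2 × OutputLetter => 1 + bitSign p.1 * softBit p.2 :=
    measurable_const.add ((measurable_bitSign.comp measurable_fst).mul
      (measurable_softBit.comp measurable_snd))
  refine (klDiv_prod_snd_le (jointLaw ν μ) (baseLaw ν)).trans ?_
  have hprob : IsProbabilityMeasure ((μ.prod (baseLaw ν)).withDensity
      fun p => ENNReal.ofReal (1 + bitSign p.1 * softBit p.2)) := by
    rw [← jointLaw_eq_withDensity]; infer_instance
  rw [fst_jointLaw, jointLaw_eq_withDensity,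
    klDiv_eq_lintegral_klFun_of_ac (withDensity_absolutelyContinuous _ _)]
  have hrn := Measure.rnDeriv_withDensity (μ.prod (baseLaw ν)) hmeas.ennreal_ofReal
  have hkl : ∀ b, ∫⁻ z, ENNReal.ofReal (klFun (1 + bitSign b * softBit z)) ∂baseLaw ν =
      ENNReal.ofReal (fairInfo ν) := by
    intro b
    rw [← ofReal_integral_eq_lintegral_ofReal
      (integrable_comp_letterDensity ν continuous_klFun b)
      (Eventually.of_forall fun z => klFun_nonneg (letterDensity_nonneg b z)),
      integral_comp_letterDensity]
    congr 1
    have h : ∀ z, klFun (1 + softBit z) =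
        (1 + softBit z) * Real.log (1 + softBit z) - softBit z := by
      intro z; rw [klFun_apply]; ring
    have hint : Integrable (fun z => (1 + softBit z) * Real.log (1 + softBit z)) (baseLaw ν) := by
      simpa [bitSign_zero] using integrable_comp_letterDensity ν Real.continuous_mul_log 0
    simp_rw [h]
    rw [integral_sub hint (integrable_softBit ν), integral_softBit, sub_zero, fairInfo]
  calc _ = ∫⁻ p, ENNReal.ofReal (klFun (1 + bitSign p.1 * softBit p.2)) ∂(μ.prod (baseLaw ν)) := by
        refine lintegral_congr_ae ?_
        filter_upwards [hrn] with p hp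
        rw [hp, ENNReal.toReal_ofReal (letterDensity_nonneg _ _)]
    _ = ∫⁻ b, ENNReal.ofReal (fairInfo ν) ∂μ := by
        have hm : Measurable fun p : ZMod 2 × OutputLetter =>
            ENNReal.ofReal (klFun (1 + bitSign p.1 * softBit p.2)) :=
          (measurable_klFun.comp hmeas).ennreal_ofReal
        rw [lintegral_prod _ hm.aemeasurable]
        exact lintegral_congr hkl
    _ ≤ _ := by simp

lemma fairInfo_nonneg : 0 ≤ fairInfo ν := by
  have hint : Integrable (fun z => (1 + softBit z) * Real.log (1 + softBit z)) (baseLaw ν) := by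
    simpa [bitSign_zero] using integrable_comp_letterDensity ν Real.continuous_mul_log 0
  rw [← integral_softBit ν]
  refine integral_mono (integrable_softBit ν) hint fun z => ?_
  have h := InformationTheory.klFun_nonneg
    (x := 1 + softBit z) (by simpa [bitSign_zero] using letterDensity_nonneg 0 z)
  rw [InformationTheory.klFun_apply] at h
  linarith

/-- The capacity of a symmetric channel is at most its mutual information for a fair input. -/
lemma capacity_mul_log_two_le : capacity ν * Real.log 2 ≤ fairInfo ν := by
  have hlog : 0 < Real.log 2 := Real.log_pos (by norm_num)
  rw [capacity, div_mul_cancel₀ _ hlog.ne']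
  exact ENNReal.toReal_le_of_le_ofReal (fairInfo_nonneg ν)
    (iSup_le fun μ => mutualInfo_le ν μ)

end

/-! ### Bounded measurable functions. -/

/-- Bounded measurable real functions. -/
def IsBddMeas {α : Type*} [MeasurableSpace α] (F : α → ℝ) : Prop :=
  Measurable F ∧ ∃ B, ∀ a, |F a| ≤ B

namespace IsBddMeas

variable {α β : Type*} [MeasurableSpace α] [MeasurableSpace β] {F G : α → ℝ}

lemma integrable (hF : IsBddMeas F) (μ : Measure α) [IsFiniteMeasure μ] : Integrable F μ := by
  obtain ⟨hm, B, hB⟩ := hF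
  exact Integrable.of_bound hm.aestronglyMeasurable B (Eventually.of_forall hB)

lemma const (r : ℝ) : IsBddMeas fun _ : α => r := ⟨measurable_const, |r|, fun _ => le_rfl⟩

lemma comp (hF : IsBddMeas F) {g : β → α} (hg : Measurable g) : IsBddMeas fun b => F (g b) :=
  ⟨hF.1.comp hg, hF.2.imp fun _ hB b => hB (g b)⟩

lemma add (hF : IsBddMeas F) (hG : IsBddMeas G) : IsBddMeas fun a => F a + G a := by
  obtain ⟨hF, A, hA⟩ := hF
  obtain ⟨hG, B, hB⟩ := hG
  exact ⟨hF.add hG, A + B, fun a => (abs_add_le _ _).trans (add_le_add (hA a) (hB a))⟩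

lemma mul (hF : IsBddMeas F) (hG : IsBddMeas G) : IsBddMeas fun a => F a * G a := by
  obtain ⟨hF, A, hA⟩ := hF
  obtain ⟨hG, B, hB⟩ := hG
  refine ⟨hF.mul hG, A * B, fun a => ?_⟩
  rw [abs_mul]
  exact mul_le_mul (hA a) (hB a) (abs_nonneg _) ((abs_nonneg _).trans (hA a))

lemma const_mul (r : ℝ) (hF : IsBddMeas F) : IsBddMeas fun a => r * F a := (const r).mul hF

lemma neg (hF : IsBddMeas F) : IsBddMeas fun a => -F a := by
  simpa using hF.const_mul (-1)

lemma sub (hF : IsBddMeas F) (hG : IsBddMeas G) : IsBddMeas fun a => F a - G a := by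
  simpa [sub_eq_add_neg] using hF.add hG.neg

lemma sum {κ : Type*} (s : Finset κ) {F : κ → α → ℝ} (hF : ∀ k, IsBddMeas (F k)) :
    IsBddMeas fun a => ∑ k ∈ s, F k a := by
  classical
  induction s using Finset.induction_on with
  | empty => simpa using const 0
  | insert k s hk ih => simpa [Finset.sum_insert hk] using (hF k).add ih

lemma prod {κ : Type*} (s : Finset κ) {F : κ → α → ℝ} (hF : ∀ k, IsBddMeas (F k)) :
    IsBddMeas fun a => ∏ k ∈ s, F k a := by
  classical
  induction s using Finset.induction_on with
  | empty => simpa using const 1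
  | insert k s hk ih => simpa [Finset.prod_insert hk] using (hF k).mul ih

lemma continuous_comp (hF : IsBddMeas F) {g : ℝ → ℝ} (hg : Continuous g) :
    IsBddMeas fun a => g (F a) := by
  obtain ⟨hF, A, hA⟩ := hF
  obtain ⟨B, hB⟩ := isCompact_Icc.exists_bound_of_continuousOn (s := Set.Icc (-A) A)
    hg.continuousOn
  exact ⟨hg.measurable.comp hF, B, fun a => hB _ (abs_le.mp (hA a))⟩

end IsBddMeas

/-! ### Conditional means over independent coordinates, and a variance bound. -/

lemma measurable_piecewise {ι E : Type*} [DecidableEq ι] [MeasurableSpace E] (S : Finset ι) :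
    Measurable fun p : (ι → E) × (ι → E) => S.piecewise p.1 p.2 := by
  refine measurable_pi_lambda _ fun i => ?_
  by_cases hi : i ∈ S
  · simpa [hi, Function.comp_def] using (measurable_pi_apply i).comp measurable_fst
  · simpa [hi, Function.comp_def] using (measurable_pi_apply i).comp measurable_snd

section ConditionalMean

variable {ι E : Type*} [Fintype ι] [DecidableEq ι] [MeasurableSpace E]
  (μ : ι → Measure E)

/-- The conditional mean of `F`, given the coordinates in `S`, for independent coordinates. -/
def condMean (S : Finset ι) (F : (ι → E) → ℝ) (y : ι → E) : ℝ :=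
  ∫ y', F (S.piecewise y y') ∂Measure.pi μ

lemma condMean_piecewise (S : Finset ι) (F : (ι → E) → ℝ) (y y' : ι → E) :
    condMean μ S F (S.piecewise y y') = condMean μ S F y := by
  unfold condMean
  refine integral_congr_ae (Eventually.of_forall fun y'' => ?_)
  dsimp only
  congr 1
  ext i
  by_cases hi : i ∈ S <;> simp [hi]

lemma condMean_insert_of_not_dependsOn {F : (ι → E) → ℝ} {P : Finset ι}
    (hF : DependsOn F (P : Set ι)) {j : ι} (hj : j ∉ P)
    (S : Finset ι) (y : ι → E) : condMean μ (insert j S) F y = condMean μ S F y := by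
  unfold condMean
  refine integral_congr_ae (Eventually.of_forall fun y' => hF fun i hi => ?_)
  have hij : i ≠ j := fun h => hj (h ▸ hi)
  by_cases hi' : i ∈ S <;> simp [hi', hij]

lemma condMean_empty (F : (ι → E) → ℝ) (y : ι → E) :
    condMean μ ∅ F y = ∫ y', F y' ∂Measure.pi μ := by
  simp [condMean]

variable [∀ i, IsProbabilityMeasure (μ i)]

/-- Resampling the coordinates outside `S` independently does not change a product law. Fubini then
gives the tower property of `condMean`. -/
lemma map_piecewise_pi (S : Finset ι) :
    ((Measure.pi μ).prod (Measure.pi μ)).map (fun p => S.piecewise p.1 p.2) = Measure.pi μ := by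
  symm
  refine Measure.pi_eq fun s hs => ?_
  rw [Measure.map_apply (measurable_piecewise S) (MeasurableSet.univ_pi hs)]
  have h : (fun p : (ι → E) × (ι → E) => S.piecewise p.1 p.2) ⁻¹' Set.univ.pi s =
      (Set.univ.pi fun i => if i ∈ S then s i else Set.univ) ×ˢ
        (Set.univ.pi fun i => if i ∈ S then Set.univ else s i) := by
    ext p
    simp only [Set.mem_preimage, Set.mem_pi, Set.mem_univ, true_imp_iff, Set.mem_prod,
      ← forall_and]
    refine forall_congr' fun i => ?_
    by_cases hi : i ∈ S <;> simp [hi]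
  rw [h, Measure.prod_prod, Measure.pi_pi, Measure.pi_pi, ← Finset.prod_mul_distrib]
  refine Finset.prod_congr rfl fun i _ => ?_
  by_cases hi : i ∈ S <;> simp [hi]

lemma integral_piecewise {F : (ι → E) → ℝ} (hF : IsBddMeas F) (S : Finset ι) :
    ∫ y, ∫ y', F (S.piecewise y y') ∂Measure.pi μ ∂Measure.pi μ = ∫ y, F y ∂Measure.pi μ := by
  conv_rhs => rw [← map_piecewise_pi μ S]
  rw [integral_map (measurable_piecewise S).aemeasurable hF.1.aestronglyMeasurable,
    integral_prod _ ((hF.comp (measurable_piecewise S)).integrable _)]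

variable {μ} in
lemma IsBddMeas.condMean {F : (ι → E) → ℝ} (hF : IsBddMeas F) (S : Finset ι) :
    IsBddMeas (condMean μ S F) := by
  obtain ⟨B, hB⟩ := hF.2
  refine ⟨(hF.comp (measurable_piecewise S)).1.stronglyMeasurable.integral_prod_right.measurable,
    B, fun y => ?_⟩
  have h := norm_integral_le_of_norm_le_const (μ := Measure.pi μ)
    (f := fun y' => F (S.piecewise y y')) (C := B) (Eventually.of_forall fun y' => hB _)
  simpa [_root_.condMean] using h

lemma condMean_univ (F : (ι → E) → ℝ) (y : ι → E) : condMean μ Finset.univ F y = F y := by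
  simp [condMean]

lemma condMean_condMean {F : (ι → E) → ℝ} (hF : IsBddMeas F) {S S' : Finset ι} (h : S ⊆ S')
    (y : ι → E) : condMean μ S (condMean μ S' F) y = condMean μ S F y := by
  have hm : Measurable fun z : ι → E => S.piecewise y z :=
    (measurable_piecewise S).comp measurable_prodMk_left
  conv_rhs => rw [condMean, ← integral_piecewise μ (hF.comp hm) S']
  unfold condMean
  refine integral_congr_ae (Eventually.of_forall fun y'' => ?_)
  refine integral_congr_ae (Eventually.of_forall fun y' => ?_)
  dsimp only
  congr 1
  ext i
  by_cases hi : i ∈ S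
  · simp [hi, h hi]
  · by_cases hi' : i ∈ S' <;> simp [hi, hi']

lemma integral_mul_eq_integral_condMean_mul {F H : (ι → E) → ℝ} (hF : IsBddMeas F)
    (hH : IsBddMeas H) (S : Finset ι) (h : ∀ y y', H (S.piecewise y y') = H y) :
    ∫ y, F y * H y ∂Measure.pi μ = ∫ y, condMean μ S F y * H y ∂Measure.pi μ := by
  rw [← integral_piecewise μ (hF.mul hH) S]
  simp_rw [h, integral_mul_const]
  rfl

/-- Pythagoras for the martingale of conditional means: the increment from `S` to `S'` is orthogonal
to functions of the coordinates in `S`. -/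
lemma integral_sq_condMean_sub {F : (ι → E) → ℝ} (hF : IsBddMeas F) {S S' : Finset ι}
    (h : S ⊆ S') :
    ∫ y, (condMean μ S' F y - condMean μ S F y) ^ 2 ∂Measure.pi μ =
      ∫ y, condMean μ S' F y ^ 2 ∂Measure.pi μ - ∫ y, condMean μ S F y ^ 2 ∂Measure.pi μ := by
  have h1 := hF.condMean (μ := μ) S
  have h2 := hF.condMean (μ := μ) S'
  have hcross := integral_mul_eq_integral_condMean_mul μ h2 h1 S (condMean_piecewise μ S F)
  simp_rw [condMean_condMean μ hF h] at hcross
  have hexp : ∀ y, (condMean μ S' F y - condMean μ S F y) ^ 2 =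
      condMean μ S' F y * condMean μ S' F y - 2 * (condMean μ S' F y * condMean μ S F y) +
        condMean μ S F y * condMean μ S F y := fun y => by ring
  simp_rw [hexp]
  rw [integral_add (((h2.mul h2).sub ((h2.mul h1).const_mul 2)).integrable _)
    ((h1.mul h1).integrable _), integral_sub ((h2.mul h2).integrable _)
    (((h2.mul h1).const_mul 2).integrable _), integral_const_mul, hcross]
  simp_rw [pow_two]
  ring

lemma condMean_sum {κ : Type*} (A : Finset κ) {F : κ → (ι → E) → ℝ} (hF : ∀ a, IsBddMeas (F a))
    (S : Finset ι) (y : ι → E) :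
    condMean μ S (fun y => ∑ a ∈ A, F a y) y = ∑ a ∈ A, condMean μ S (F a) y := by
  have hm : Measurable fun z : ι → E => S.piecewise y z :=
    (measurable_piecewise S).comp measurable_prodMk_left
  exact integral_finsetSum A fun a _ => ((hF a).comp hm).integrable _

/-- The variance of a sum of functions of independent coordinates, when each coordinate is used by
at most `r` of them, is at most `r` times the sum of their variances. -/
lemma variance_sum_le {κ : Type*} (A : Finset κ) {F : κ → (ι → E) → ℝ}
    (hF : ∀ a, IsBddMeas (F a)) (P : κ → Finset ι)
    (hP : ∀ a, DependsOn (F a) (P a : Set ι))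
    {r : ℝ} (hr : ∀ j, ((A.filter fun a => j ∈ P a).card : ℝ) ≤ r) :
    ∫ y, (∑ a ∈ A, F a y) ^ 2 ∂Measure.pi μ - (∫ y, ∑ a ∈ A, F a y ∂Measure.pi μ) ^ 2 ≤
      r * ∑ a ∈ A, (∫ y, F a y ^ 2 ∂Measure.pi μ - (∫ y, F a y ∂Measure.pi μ) ^ 2) := by
  have hsum := IsBddMeas.sum A hF
  -- Coordinates are revealed one at a time. The increment at `j` involves only the summands that
  -- use `j`, at most `r` of them, so Cauchy–Schwarz costs a factor `r`; orthogonality of increments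
  -- then adds up the steps.
  have key : ∀ S : Finset ι,
      ∫ y, condMean μ S (fun y => ∑ a ∈ A, F a y) y ^ 2 ∂Measure.pi μ -
          (∫ y, ∑ a ∈ A, F a y ∂Measure.pi μ) ^ 2 ≤
        r * ∑ a ∈ A, (∫ y, condMean μ S (F a) y ^ 2 ∂Measure.pi μ -
          (∫ y, F a y ∂Measure.pi μ) ^ 2) := by
    intro S
    induction S using Finset.induction_on with
    | empty => simp [condMean_empty]
    | insert j S hj ih =>
      have hstep := integral_sq_condMean_sub μ hsum (Finset.subset_insert j S)
      have hstep' := fun a => integral_sq_condMean_sub μ (hF a) (Finset.subset_insert j S)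
      set D : κ → (ι → E) → ℝ := fun a y =>
        condMean μ (insert j S) (F a) y - condMean μ S (F a) y with hD
      have hDb : ∀ a, IsBddMeas fun y => D a y ^ 2 := fun a => by
        have h := ((hF a).condMean (μ := μ) (insert j S)).sub ((hF a).condMean (μ := μ) S)
        simpa only [pow_two] using h.mul h
      have hpt : ∀ y, (condMean μ (insert j S) (fun y => ∑ a ∈ A, F a y) y -
          condMean μ S (fun y => ∑ a ∈ A, F a y) y) ^ 2 ≤ r * ∑ a ∈ A, D a y ^ 2 := by
        intro y
        have h0 : ∀ a ∈ A, D a y ≠ 0 → j ∈ P a := by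
          intro a _ hne
          by_contra hja
          exact hne (by simp [hD, condMean_insert_of_not_dependsOn μ (hP a) hja])
        rw [condMean_sum μ A hF, condMean_sum μ A hF, ← Finset.sum_sub_distrib]
        change (∑ a ∈ A, D a y) ^ 2 ≤ _
        rw [← Finset.sum_filter_of_ne h0]
        calc (∑ a ∈ A with j ∈ P a, D a y) ^ 2
            ≤ (A.filter fun a => j ∈ P a).card * ∑ a ∈ A with j ∈ P a, D a y ^ 2 :=
              sq_sum_le_card_mul_sum_sq
          _ ≤ r * ∑ a ∈ A with j ∈ P a, D a y ^ 2 :=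
              mul_le_mul_of_nonneg_right (hr j) (Finset.sum_nonneg fun _ _ => sq_nonneg _)
          _ ≤ r * ∑ a ∈ A, D a y ^ 2 := by
              refine mul_le_mul_of_nonneg_left ?_ ((Nat.cast_nonneg _).trans (hr j))
              exact Finset.sum_le_sum_of_subset_of_nonneg (Finset.filter_subset _ _)
                fun _ _ _ => sq_nonneg _
      have hint := integral_mono
        (((hsum.condMean (μ := μ) (insert j S)).sub
          (hsum.condMean (μ := μ) S)).continuous_comp (continuous_pow 2)
          |>.integrable (Measure.pi μ))
        (((IsBddMeas.sum A hDb).const_mul r).integrable (Measure.pi μ)) hpt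
      rw [integral_const_mul, integral_finsetSum A fun a _ => (hDb a).integrable _] at hint
      rw [hstep] at hint
      simp_rw [hD, hstep'] at hint
      rw [Finset.sum_sub_distrib] at hint ih ⊢
      rw [mul_sub] at hint ih ⊢
      linarith
  simpa only [condMean_univ] using key Finset.univ

end ConditionalMean

/-! ### Output words: densities relative to the base law. -/

section Words

variable {n : ℕ}

/-- The output law of `n` independent uses of the channel with fair input bits. -/
def wordBase (ν : Measure Crossover) (n : ℕ) : Measure (Fin n → OutputLetter) :=
  Measure.pi fun _ => baseLaw ν

instance (ν : Measure Crossover) [IsProbabilityMeasure ν] :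
    IsProbabilityMeasure (wordBase ν n) := by
  unfold wordBase; infer_instance

/-- The density, with respect to the base law, of the outputs on `S` when the word `c` is sent. -/
def wordDensity (S : Finset (Fin n)) (c : Fin n → ZMod 2) (y : Fin n → OutputLetter) : ℝ :=
  ∏ j ∈ S, (1 + bitSign (c j) * softBit (y j))

lemma wordDensity_nonneg (S : Finset (Fin n)) (c : Fin n → ZMod 2) (y : Fin n → OutputLetter) :
    0 ≤ wordDensity S c y :=
  Finset.prod_nonneg fun _ _ => letterDensity_nonneg _ _

lemma isBddMeas_softBit (j : Fin n) :
    IsBddMeas fun y : Fin n → OutputLetter => softBit (y j) :=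
  ⟨measurable_softBit.comp (measurable_pi_apply j), 1, fun _ => abs_softBit_le _⟩

lemma isBddMeas_wordDensity (S : Finset (Fin n)) (c : Fin n → ZMod 2) :
    IsBddMeas (wordDensity S c) :=
  IsBddMeas.prod S fun j => (IsBddMeas.const 1).add ((isBddMeas_softBit j).const_mul _)

lemma wordDensity_insert {S : Finset (Fin n)} {j : Fin n} (hj : j ∉ S) (c : Fin n → ZMod 2)
    (y : Fin n → OutputLetter) :
    wordDensity (insert j S) c y = (1 + bitSign (c j) * softBit (y j)) * wordDensity S c y :=
  Finset.prod_insert hj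

lemma dependsOn_wordDensity (S : Finset (Fin n)) (c : Fin n → ZMod 2) :
    DependsOn (wordDensity S c) (S : Set (Fin n)) := fun y y' h =>
  Finset.prod_congr rfl fun j hj => by rw [h j hj]

/-- Addition of a word to the bits of an output word. -/
def wordShift (a : Fin n → ZMod 2) (y : Fin n → OutputLetter) : Fin n → OutputLetter :=
  fun j => letterShift (a j) (y j)

lemma wordDensity_wordShift (S : Finset (Fin n)) (c a : Fin n → ZMod 2)
    (y : Fin n → OutputLetter) :
    wordDensity S c (wordShift a y) = wordDensity S (c + a) y := by
  simp only [wordDensity, wordShift, softBit_letterShift, Pi.add_apply, bitSign_add, mul_assoc]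

lemma DependsOn.wordShift_single {β : Type*} {G : (Fin n → OutputLetter) → β} {S : Set (Fin n)}
    (hG : DependsOn G S) {j : Fin n} (hj : j ∉ S) (y : Fin n → OutputLetter) :
    G (wordShift (Pi.single j 1) y) = G y :=
  hG fun i hi => by
    have hij : i ≠ j := fun h => hj (h ▸ hi)
    simp [wordShift, letterShift, hij]

variable (ν : Measure Crossover) [IsProbabilityMeasure ν]

lemma integral_comp_wordShift (a : Fin n → ZMod 2) {F : (Fin n → OutputLetter) → ℝ}
    (hF : IsBddMeas F) : ∫ y, F (wordShift a y) ∂wordBase ν n = ∫ y, F y ∂wordBase ν n := by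
  have h : MeasurePreserving (wordShift a) (wordBase ν n) (wordBase ν n) :=
    measurePreserving_pi _ _ fun j => measurePreserving_letterShift ν (a j)
  conv_rhs => rw [← h.map_eq]
  rw [integral_map h.measurable.aemeasurable hF.1.aestronglyMeasurable]

/-- Flipping output bit `j` preserves the base law and changes the sign of the soft bit, while `G`
is unaffected. This is what removes the terms linear in a new letter. -/
lemma integral_softBit_mul_eq_zero {G : (Fin n → OutputLetter) → ℝ} (hG : IsBddMeas G) {j : Fin n}
    (h : ∀ y, G (wordShift (Pi.single j 1) y) = G y) :
    ∫ y, softBit (y j) * G y ∂wordBase ν n = 0 := by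
  have hs := integral_comp_wordShift ν (Pi.single j 1) ((isBddMeas_softBit j).mul hG)
  have hu : ∀ y : Fin n → OutputLetter,
      softBit (wordShift (Pi.single j 1) y j) = -softBit (y j) := by
    intro y
    simp [wordShift, softBit_letterShift, bitSign_one]
  simp only [h, hu, neg_mul, integral_neg] at hs
  linarith

lemma integral_mul_wordDensity_insert {G : (Fin n → OutputLetter) → ℝ} (hG : IsBddMeas G)
    {S : Finset (Fin n)} {j : Fin n} (hj : j ∉ S) (c : Fin n → ZMod 2)
    (h : ∀ y, G (wordShift (Pi.single j 1) y) = G y) :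
    ∫ y, G y * wordDensity (insert j S) c y ∂wordBase ν n =
      ∫ y, G y * wordDensity S c y ∂wordBase ν n := by
  have hL := isBddMeas_wordDensity S c
  have hexp : ∀ y, G y * wordDensity (insert j S) c y =
      G y * wordDensity S c y + bitSign (c j) * (softBit (y j) * (G y * wordDensity S c y)) := by
    intro y; rw [wordDensity_insert hj]; ring
  simp_rw [hexp]
  rw [integral_add ((hG.mul hL).integrable _)
    ((((isBddMeas_softBit j).mul (hG.mul hL)).const_mul _).integrable _), integral_const_mul,
    integral_softBit_mul_eq_zero ν (hG.mul hL), mul_zero, add_zero]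
  intro y
  rw [h, (dependsOn_wordDensity S c).wordShift_single (by simpa using hj)]

/-- Outputs outside `S` can be integrated out. -/
lemma integral_mul_wordDensity_union {G : (Fin n → OutputLetter) → ℝ} (hG : IsBddMeas G)
    (S S' : Finset (Fin n)) (c : Fin n → ZMod 2)
    (h : ∀ j ∈ S', j ∉ S → ∀ y, G (wordShift (Pi.single j 1) y) = G y) :
    ∫ y, G y * wordDensity (S' ∪ S) c y ∂wordBase ν n =
      ∫ y, G y * wordDensity S c y ∂wordBase ν n := by
  induction S' using Finset.induction_on with
  | empty => simp
  | insert j S' hj ih =>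
    rw [Finset.insert_union]
    have ih' := ih fun i hi => h i (Finset.mem_insert_of_mem hi)
    by_cases hjS : j ∈ S
    · rwa [Finset.insert_eq_of_mem (Finset.mem_union_right _ hjS)]
    · rw [integral_mul_wordDensity_insert ν hG (by simp [hj, hjS]) c
        (h j (Finset.mem_insert_self _ _) hjS), ih']

lemma integral_mul_wordDensity_univ {G : (Fin n → OutputLetter) → ℝ} (hG : IsBddMeas G)
    {S : Finset (Fin n)} (hS : DependsOn G (S : Set (Fin n))) (c : Fin n → ZMod 2) :
    ∫ y, G y * wordDensity Finset.univ c y ∂wordBase ν n =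
      ∫ y, G y * wordDensity S c y ∂wordBase ν n := by
  have h := integral_mul_wordDensity_union ν hG S Finset.univ c
    fun j _ hj => hS.wordShift_single (by simpa using hj)
  rwa [Finset.union_eq_left.mpr (Finset.subset_univ S)] at h

lemma integral_mul_wordDensity_eq_integral {G : (Fin n → OutputLetter) → ℝ} (hG : IsBddMeas G)
    {S : Finset (Fin n)} (c : Fin n → ZMod 2)
    (h : ∀ j ∈ S, ∀ y, G (wordShift (Pi.single j 1) y) = G y) :
    ∫ y, G y * wordDensity S c y ∂wordBase ν n = ∫ y, G y ∂wordBase ν n := by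
  have h := integral_mul_wordDensity_union ν hG ∅ S c fun j hj _ => h j hj
  simpa [wordDensity] using h

lemma integral_wordDensity (S : Finset (Fin n)) (c : Fin n → ZMod 2) :
    ∫ y, wordDensity S c y ∂wordBase ν n = 1 := by
  simpa using integral_mul_wordDensity_eq_integral ν (IsBddMeas.const 1) (S := S) c
    fun _ _ _ => rfl

lemma integral_comp_eval (j : Fin n) {F : OutputLetter → ℝ} (hF : IsBddMeas F) :
    ∫ y, F (y j) ∂wordBase ν n = ∫ z, F z ∂baseLaw ν := by
  have h := measurePreserving_eval (fun _ : Fin n => baseLaw ν) j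
  conv_rhs => rw [← h.map_eq]
  rw [integral_map h.measurable.aemeasurable hF.1.aestronglyMeasurable]
  rfl

/-- The information that the outputs on `S` carry about a known word, relative to the base law. -/
lemma integral_wordDensity_mul_log (S : Finset (Fin n)) (c : Fin n → ZMod 2) :
    ∫ y, wordDensity S c y * Real.log (wordDensity S c y) ∂wordBase ν n =
      S.card * fairInfo ν := by
  induction S using Finset.induction_on with
  | empty => simp [wordDensity]
  | insert j S hj ih =>
    have hL := isBddMeas_wordDensity S c
    have hLlog : IsBddMeas fun y => wordDensity S c y * Real.log (wordDensity S c y) :=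
      hL.continuous_comp Real.continuous_mul_log
    have hletter : IsBddMeas fun z : OutputLetter => 1 + bitSign (c j) * softBit z :=
      (IsBddMeas.const 1).add (IsBddMeas.const_mul _
        ⟨measurable_softBit, 1, abs_softBit_le⟩)
    have hψ : IsBddMeas fun z : OutputLetter => (1 + bitSign (c j) * softBit z) *
        Real.log (1 + bitSign (c j) * softBit z) :=
      hletter.continuous_comp Real.continuous_mul_log
    have hψj := hψ.comp (measurable_pi_apply (X := fun _ : Fin n => OutputLetter) j)
    -- The logarithm of the product splits; the convention log 0 = 0 covers vanishing factors. The
    -- middle term is odd in letter `j` and integrates to zero.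
    have hexp : ∀ y, wordDensity (insert j S) c y * Real.log (wordDensity (insert j S) c y) =
        wordDensity S c y * Real.log (wordDensity S c y) +
        bitSign (c j) * (softBit (y j) * (wordDensity S c y * Real.log (wordDensity S c y))) +
        (1 + bitSign (c j) * softBit (y j)) * Real.log (1 + bitSign (c j) * softBit (y j)) *
          wordDensity S c y := by
      intro y
      rw [wordDensity_insert hj]
      rcases eq_or_ne (wordDensity S c y) 0 with h0 | h0
      · simp [h0]
      rcases eq_or_ne (1 + bitSign (c j) * softBit (y j)) 0 with h1 | h1
      · have : bitSign (c j) * softBit (y j) = -1 := by linarith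
        rw [← mul_assoc (bitSign (c j)), h1, this]
        ring
      · rw [Real.log_mul h1 h0]; ring
    simp_rw [hexp]
    rw [integral_add ((hLlog.add (((isBddMeas_softBit j).mul hLlog).const_mul _)).integrable _)
      ((hψj.mul hL).integrable _), integral_add (hLlog.integrable _)
      ((((isBddMeas_softBit j).mul hLlog).const_mul _).integrable _), integral_const_mul,
      integral_softBit_mul_eq_zero ν hLlog, ih,
      integral_mul_wordDensity_eq_integral ν hψj, integral_comp_eval ν j hψ,
      integral_comp_letterDensity ν (fun t => t * Real.log t) (c j),
      Finset.card_insert_of_notMem hj]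
    · rw [fairInfo]; push_cast; ring
    · intro i hi y
      have hij : j ≠ i := fun h => hj (h ▸ hi)
      simp [wordShift, letterShift, hij]
    · intro y
      rw [(dependsOn_wordDensity S c).wordShift_single (by simpa using hj)]

end Words

/-! ### Codes: averaged densities and soft decisions. -/

section Codes

open scoped Classical

variable {n : ℕ} (C : BinaryCode n)

/-- The mean, over a uniformly drawn codeword `c`, of `φ c` times the density of the outputs on
`S` when `c` is sent. -/
def codeAvg (S : Finset (Fin n)) (φ : (Fin n → ZMod 2) → ℝ) (y : Fin n → OutputLetter) : ℝ :=
  (∑ c : C, φ c * wordDensity S c y) / Fintype.card C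

/-- The conditional mean of `(-1)^(X_i)` given the outputs on `S`, for a uniformly drawn codeword
`X`. -/
def softDecision (S : Finset (Fin n)) (i : Fin n) (y : Fin n → OutputLetter) : ℝ :=
  codeAvg C S (fun c => bitSign (c i)) y / codeAvg C S (fun _ => 1) y

lemma card_code_pos : (0 : ℝ) < Fintype.card C := by exact_mod_cast Fintype.card_pos

lemma codeAvg_one_nonneg (S : Finset (Fin n)) (y : Fin n → OutputLetter) :
    0 ≤ codeAvg C S (fun _ => 1) y :=
  div_nonneg (Finset.sum_nonneg fun _ _ => mul_nonneg zero_le_one (wordDensity_nonneg _ _ _))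
    (card_code_pos C).le

lemma abs_codeAvg_le (S : Finset (Fin n)) {φ : (Fin n → ZMod 2) → ℝ} (hφ : ∀ c, |φ c| ≤ 1)
    (y : Fin n → OutputLetter) : |codeAvg C S φ y| ≤ codeAvg C S (fun _ => 1) y := by
  rw [codeAvg, abs_div, abs_of_pos (card_code_pos C)]
  refine div_le_div_of_nonneg_right ((Finset.abs_sum_le_sum_abs _ _).trans ?_)
    (card_code_pos C).le
  refine Finset.sum_le_sum fun c _ => ?_
  rw [abs_mul, abs_of_nonneg (wordDensity_nonneg _ _ _)]
  exact mul_le_mul_of_nonneg_right (hφ c) (wordDensity_nonneg _ _ _)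

lemma abs_codeAvg_bitSign_le (S : Finset (Fin n)) (i : Fin n) (y : Fin n → OutputLetter) :
    |codeAvg C S (fun c => bitSign (c i)) y| ≤ codeAvg C S (fun _ => 1) y :=
  abs_codeAvg_le C S (fun c => (abs_bitSign (c i)).le) y

lemma abs_softDecision_le (S : Finset (Fin n)) (i : Fin n) (y : Fin n → OutputLetter) :
    |softDecision C S i y| ≤ 1 := by
  rw [softDecision, abs_div, abs_of_nonneg (codeAvg_one_nonneg C S y)]
  exact div_le_one_of_le₀ (abs_codeAvg_bitSign_le C S i y) (codeAvg_one_nonneg C S y)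

/-- This survives the convention x / 0 = 0: where the denominator vanishes, so does the numerator,
which it dominates. -/
lemma softDecision_mul_codeAvg (S : Finset (Fin n)) (i : Fin n) (y : Fin n → OutputLetter) :
    softDecision C S i y * codeAvg C S (fun _ => 1) y = codeAvg C S (fun c => bitSign (c i)) y := by
  rcases eq_or_ne (codeAvg C S (fun _ => 1) y) 0 with h | h
  · have := abs_codeAvg_bitSign_le C S i y
    rw [h] at this ⊢
    rw [abs_nonpos_iff.mp this, mul_zero]
  · rw [softDecision, div_mul_cancel₀ _ h]

lemma isBddMeas_codeAvg (S : Finset (Fin n)) (φ : (Fin n → ZMod 2) → ℝ) :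
    IsBddMeas (codeAvg C S φ) := by
  have h := (IsBddMeas.sum Finset.univ fun c : C =>
    (isBddMeas_wordDensity S (c : Fin n → ZMod 2)).const_mul (φ c)).mul
    (IsBddMeas.const ((Fintype.card C : ℝ)⁻¹))
  exact h

lemma isBddMeas_softDecision (S : Finset (Fin n)) (i : Fin n) :
    IsBddMeas (softDecision C S i) :=
  ⟨(isBddMeas_codeAvg C S _).1.div (isBddMeas_codeAvg C S _).1, 1, abs_softDecision_le C S i⟩

lemma dependsOn_codeAvg (S : Finset (Fin n)) (φ : (Fin n → ZMod 2) → ℝ) :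
    DependsOn (codeAvg C S φ) (S : Set (Fin n)) := fun y y' h => by
  simp only [codeAvg, dependsOn_wordDensity S _ h]

lemma dependsOn_softDecision (S : Finset (Fin n)) (i : Fin n) :
    DependsOn (softDecision C S i) (S : Set (Fin n)) := fun y y' h => by
  simp only [softDecision, dependsOn_codeAvg C S _ h]

/-- A new letter enters affinely through its soft bit; both the information bound and the
monotonicity of energy rest on this expansion. -/
lemma codeAvg_insert {S : Finset (Fin n)} {j : Fin n} (hj : j ∉ S) (φ : (Fin n → ZMod 2) → ℝ)
    (y : Fin n → OutputLetter) :
    codeAvg C (insert j S) φ y =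
      codeAvg C S φ y + softBit (y j) * codeAvg C S (fun c => φ c * bitSign (c j)) y := by
  rw [codeAvg, codeAvg, codeAvg, ← mul_div_assoc, ← add_div, Finset.mul_sum,
    ← Finset.sum_add_distrib]
  congr 1
  refine Finset.sum_congr rfl fun c _ => ?_
  rw [wordDensity_insert hj]; ring

lemma codeAvg_wordShift (S : Finset (Fin n)) (φ : (Fin n → ZMod 2) → ℝ) (a : C)
    (y : Fin n → OutputLetter) :
    codeAvg C S φ (wordShift a y) = codeAvg C S (fun c => φ (c + a)) y := by
  rw [codeAvg, codeAvg]
  congr 1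
  rw [← Equiv.sum_comp (Equiv.addRight a)]
  refine Finset.sum_congr rfl fun c _ => ?_
  have haa : (a : Fin n → ZMod 2) + a = 0 := by
    ext j
    have : ∀ b : ZMod 2, b + b = 0 := by decide
    exact this _
  rw [wordDensity_wordShift]
  simp [add_assoc, haa]

/-- Translating by a codeword only relabels the uniform codeword. This equivariance reduces every
transmitted codeword to zero. -/
lemma softDecision_wordShift (S : Finset (Fin n)) (i : Fin n) (a : C)
    (y : Fin n → OutputLetter) :
    softDecision C S i (wordShift a y) = bitSign (a.1 i) * softDecision C S i y := by
  rw [softDecision, codeAvg_wordShift, codeAvg_wordShift, softDecision, ← mul_div_assoc]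
  congr 1
  rw [codeAvg, codeAvg, ← mul_div_assoc, Finset.mul_sum]
  congr 1
  refine Finset.sum_congr rfl fun c _ => ?_
  rw [Pi.add_apply, bitSign_add]; ring

/-- A symmetry of a code permutes its codewords. -/
def IsCodeSymmetry.codeEquiv {C : BinaryCode n} {σ : Equiv.Perm (Fin n)}
    (hσ : IsCodeSymmetry C σ) : C ≃ C where
  toFun c := ⟨c.1 ∘ σ, (hσ c.1).mpr c.2⟩
  invFun c := ⟨c.1 ∘ σ.symm, (hσ _).mp (by simp [Function.comp_assoc, c.2])⟩
  left_inv c := by ext; simp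
  right_inv c := by ext; simp

lemma softDecision_map {σ : Equiv.Perm (Fin n)} (hσ : IsCodeSymmetry C σ) (S : Finset (Fin n))
    (i : Fin n) (y : Fin n → OutputLetter) :
    softDecision C (S.map σ.toEmbedding) (σ i) y = softDecision C S i (y ∘ σ) := by
  have hL : ∀ c : Fin n → ZMod 2,
      wordDensity (S.map σ.toEmbedding) c y = wordDensity S (c ∘ σ) (y ∘ σ) := fun c => by
    simp [wordDensity]
  have h : ∀ φ : (Fin n → ZMod 2) → ℝ, codeAvg C (S.map σ.toEmbedding) (fun c => φ (c ∘ σ)) y =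
      codeAvg C S φ (y ∘ σ) := by
    intro φ
    simp only [codeAvg, hL]
    congr 1
    exact Equiv.sum_comp hσ.codeEquiv fun c : C => φ c * wordDensity S c (y ∘ σ)
  rw [softDecision, softDecision, ← h, ← h]
  rfl

/-! ### Block information against decision energy. -/

variable (ν : Measure Crossover) [IsProbabilityMeasure ν]

/-- The second moment of the soft decision on bit `i` from the outputs on `S`. -/
def decisionEnergy (S : Finset (Fin n)) (i : Fin n) : ℝ :=
  ∫ y, softDecision C S i y * codeAvg C S (fun c => bitSign (c i)) y ∂wordBase ν n

/-- The divergence from the base law of the law of the outputs on `S`, for a uniformly drawn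
codeword. -/
def blockInfo (S : Finset (Fin n)) : ℝ :=
  ∫ y, codeAvg C S (fun _ => 1) y * Real.log (codeAvg C S (fun _ => 1) y) ∂wordBase ν n

/-- With s = g f the left side is f (1 + u g) log(f (1 + u g)). Bounding log(1 + u g) by u g and u²
by 1 leaves, besides f log f and terms linear in u, only g s. In use, u is the new soft bit, whose
linear terms integrate to zero, and g s is the energy density. -/
lemma mul_log_add_mul_le {f s u g : ℝ} (hf : 0 ≤ f) (hs : |s| ≤ f) (hu : |u| ≤ 1)
    (hg : g * f = s) :
    (f + u * s) * Real.log (f + u * s) ≤ f * Real.log f + u * (s * Real.log f + s) + g * s := by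
  rcases hf.eq_or_lt with rfl | hf
  · have : s = 0 := by simpa using hs
    simp [this]
  subst hg
  have hg1 : |g| ≤ 1 := by
    rw [abs_mul, abs_of_pos hf] at hs
    exact le_of_mul_le_mul_right (by linarith) hf
  have hug : |u * g| ≤ 1 := by
    rw [abs_mul]; exact mul_le_one₀ hu (abs_nonneg _) hg1
  have h1 : 0 ≤ 1 + u * g := by linarith [neg_le_of_abs_le hug]
  have hlog : (1 + u * g) * Real.log (1 + u * g) ≤ (1 + u * g) * (u * g) := by
    rcases h1.eq_or_lt with h | h
    · simp [← h]
    · exact mul_le_mul_of_nonneg_left (by linarith [Real.log_le_sub_one_of_pos h]) h1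
  have hu2 : u ^ 2 ≤ 1 := by rw [← sq_abs]; exact pow_le_one₀ (abs_nonneg _) hu
  have hmain : (f + u * (g * f)) * Real.log (f + u * (g * f)) =
      f * Real.log f * (1 + u * g) + f * ((1 + u * g) * Real.log (1 + u * g)) := by
    have hfac : f + u * (g * f) = f * (1 + u * g) := by ring
    rw [hfac]
    rcases h1.eq_or_lt with h | h
    · simp [← h]
    · rw [Real.log_mul hf.ne' h.ne']; ring
  rw [hmain]
  have h2 := mul_le_mul_of_nonneg_left hlog hf.le
  have h3 : 0 ≤ f * g ^ 2 * (1 - u ^ 2) := by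
    have : 0 ≤ 1 - u ^ 2 := by linarith
    positivity
  nlinarith [h2, h3]

/-- The logarithm is unbounded near zero density, but the product is the soft decision times t log
t. -/
lemma isBddMeas_codeAvg_mul_log (S : Finset (Fin n)) (i : Fin n) :
    IsBddMeas fun y => codeAvg C S (fun c => bitSign (c i)) y *
      Real.log (codeAvg C S (fun _ => 1) y) := by
  have h := (isBddMeas_softDecision C S i).mul
    ((isBddMeas_codeAvg C S (fun _ => 1)).continuous_comp Real.continuous_mul_log)
  convert h using 2 with y
  rw [← mul_assoc, softDecision_mul_codeAvg]

lemma blockInfo_insert_le {S : Finset (Fin n)} {i : Fin n} (hi : i ∉ S) :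
    blockInfo C ν (insert i S) ≤ blockInfo C ν S + decisionEnergy C ν S i := by
  have hins : ∀ y, codeAvg C (insert i S) (fun _ => 1) y = codeAvg C S (fun _ => 1) y +
      softBit (y i) * codeAvg C S (fun c => bitSign (c i)) y := by
    intro y; simp only [codeAvg_insert C hi, one_mul]
  have hs := isBddMeas_codeAvg C S fun c => bitSign (c i)
  have hf := (isBddMeas_codeAvg C S fun _ => 1).continuous_comp Real.continuous_mul_log
  have hsl := (isBddMeas_codeAvg_mul_log C S i).add hs
  have hgs := (isBddMeas_softDecision C S i).mul hs
  have hu := (isBddMeas_softBit i).mul hsl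
  have hmono := integral_mono
    (((isBddMeas_codeAvg C (insert i S) fun _ => 1).continuous_comp
      Real.continuous_mul_log).integrable (wordBase ν n))
    (((hf.add hu).add hgs).integrable (wordBase ν n)) fun y => by
      dsimp only
      rw [hins]
      exact mul_log_add_mul_le (codeAvg_one_nonneg C S y) (abs_codeAvg_bitSign_le C S i y)
        (abs_softBit_le (y i)) (softDecision_mul_codeAvg C S i y)
  rw [integral_add ((hf.add hu).integrable _) (hgs.integrable _),
    integral_add (hf.integrable _) (hu.integrable _),
    integral_softBit_mul_eq_zero ν hsl, add_zero] at hmono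
  · exact hmono
  · intro y
    have hi' : i ∉ (S : Set (Fin n)) := by simpa using hi
    rw [(dependsOn_codeAvg C S _).wordShift_single hi',
      (dependsOn_codeAvg C S _).wordShift_single hi']

/-- The finer soft decision is the better least-squares estimator: the squared difference of the two
decisions, weighted by the finer density, is nonnegative. Expanding it leaves the difference of the
energy densities and a term linear in the new soft bit. -/
lemma decisionEnergy_le_insert {S : Finset (Fin n)} {j : Fin n} (hj : j ∉ S) (i : Fin n) :
    decisionEnergy C ν S i ≤ decisionEnergy C ν (insert j S) i := by
  have hj' : j ∉ (S : Set (Fin n)) := by simpa using hj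
  have hg := isBddMeas_softDecision C S i
  have hs := isBddMeas_codeAvg C S fun c => bitSign (c i)
  have hb := isBddMeas_codeAvg C S fun c => bitSign (c i) * bitSign (c j)
  have ha := isBddMeas_codeAvg C S fun c => 1 * bitSign (c j)
  have hrest := ((hg.mul hb).const_mul 2).sub (ha.mul (hg.mul hg))
  have hu := (isBddMeas_softBit j).mul hrest
  have hgs := hg.mul hs
  have hmono := integral_mono ((hgs.add hu).integrable (wordBase ν n))
    (((isBddMeas_softDecision C (insert j S) i).mul
      (isBddMeas_codeAvg C (insert j S) fun c => bitSign (c i))).integrable (wordBase ν n))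
    fun y => by
      dsimp only
      have h1 := softDecision_mul_codeAvg C (insert j S) i y
      have h2 := softDecision_mul_codeAvg C S i y
      have h3 := codeAvg_one_nonneg C (insert j S) y
      have h4 := codeAvg_insert C hj (fun c => bitSign (c i)) y
      have h5 := codeAvg_insert C hj (fun _ => 1) y
      have h6 := mul_nonneg h3
        (sq_nonneg (softDecision C (insert j S) i y - softDecision C S i y))
      rw [h4] at h1 ⊢
      rw [h5] at h1 h6
      rw [← h2] at h1 ⊢
      linear_combination h6 + (softDecision C (insert j S) i y - 2 * softDecision C S i y) * h1
  rw [integral_add (hgs.integrable _) (hu.integrable _),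
    integral_softBit_mul_eq_zero ν hrest, add_zero] at hmono
  · exact hmono
  · intro y
    rw [(dependsOn_codeAvg C S _).wordShift_single hj',
      (dependsOn_codeAvg C S _).wordShift_single hj',
      (dependsOn_softDecision C S _).wordShift_single hj']

lemma decisionEnergy_mono {S S' : Finset (Fin n)} (h : S ⊆ S') (i : Fin n) :
    decisionEnergy C ν S i ≤ decisionEnergy C ν S' i := by
  suffices H : ∀ T : Finset (Fin n), decisionEnergy C ν S i ≤ decisionEnergy C ν (T ∪ S) i by
    simpa [Finset.union_eq_left.mpr h] using H S'
  intro T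
  induction T using Finset.induction_on with
  | empty => simp
  | insert j T hj ih =>
    rw [Finset.insert_union]
    by_cases hjS : j ∈ T ∪ S
    · rwa [Finset.insert_eq_of_mem hjS]
    · exact ih.trans (decisionEnergy_le_insert C ν hjS i)

/-- The information in the outputs on `P` is at most the total energy of the soft decisions on the
bits of `P` from the other outputs on `P`. -/
lemma blockInfo_le_sum_decisionEnergy (P : Finset (Fin n)) :
    blockInfo C ν P ≤ ∑ i ∈ P, decisionEnergy C ν (P.erase i) i := by
  suffices H : ∀ S ⊆ P, blockInfo C ν S ≤ ∑ i ∈ S, decisionEnergy C ν (P.erase i) i from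
    H P subset_rfl
  intro S
  induction S using Finset.induction_on with
  | empty =>
    intro _
    have : ∀ y, codeAvg C ∅ (fun _ => 1) y = 1 := fun y => by
      simp [codeAvg, wordDensity]
    simp [blockInfo, this]
  | insert i S hi ih =>
    intro hS
    rw [Finset.sum_insert hi]
    have h1 := ih fun j hj => hS (Finset.mem_insert_of_mem hj)
    have h2 := decisionEnergy_mono C ν (S := S) (S' := P.erase i)
      (fun j hj => Finset.mem_erase.mpr ⟨fun h => hi (h ▸ hj), hS (Finset.mem_insert_of_mem hj)⟩) i
    linarith [blockInfo_insert_le C ν hi]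

/-- The codewords agreeing with `c` on `P` form a coset of the kernel of restriction, hence a
fraction 2^(-d) of the code, with d the dimension of the restricted code. They all have the density
of `c` on `P`; the other terms are dropped. -/
lemma codeAvg_one_ge (P : Finset (Fin n)) (c : C) (y : Fin n → OutputLetter) :
    wordDensity P c y / 2 ^ Module.finrank (ZMod 2) (codeRestrict C P) ≤
      codeAvg C P (fun _ => 1) y := by
  set f : C →ₗ[ZMod 2] (P → ZMod 2) :=
    (LinearMap.funLeft (ZMod 2) (ZMod 2) (Subtype.val : P → Fin n)).comp C.subtype with hf
  have hrange : codeRestrict C P = LinearMap.range f := by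
    rw [hf, LinearMap.range_comp, Submodule.range_subtype]; rfl
  have hcard : (Fintype.card C : ℝ) =
      2 ^ Module.finrank (ZMod 2) (codeRestrict C P) * Fintype.card (LinearMap.ker f) := by
    have h1 := LinearMap.finrank_range_add_finrank_ker f
    rw [Module.card_eq_pow_finrank (K := ZMod 2) (V := C), Module.card_eq_pow_finrank
      (K := ZMod 2) (V := LinearMap.ker f), hrange, ← h1, ZMod.card]
    push_cast
    rw [pow_add]
  have hker : ∀ k : LinearMap.ker f, wordDensity P (c + k.1 : C) y = wordDensity P c y := by
    intro k
    refine Finset.prod_congr rfl fun j hj => ?_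
    have hk : f k.1 = 0 := k.2
    have hkj : (k.1 : Fin n → ZMod 2) j = 0 := congrFun hk ⟨j, hj⟩
    simp [hkj]
  have hsum : Fintype.card (LinearMap.ker f) * wordDensity P c y ≤
      ∑ c' : C, wordDensity P c' y := by
    calc Fintype.card (LinearMap.ker f) * wordDensity P c y
        = ∑ k : LinearMap.ker f, wordDensity P (c + k.1 : C) y := by
          simp only [hker, Finset.sum_const, Finset.card_univ, nsmul_eq_mul]
      _ = ∑ c' ∈ Finset.univ.map ⟨fun k : LinearMap.ker f => c + k.1,
            fun a b h => Subtype.ext (add_left_cancel h)⟩, wordDensity P c' y := by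
          rw [Finset.sum_map]; rfl
      _ ≤ _ := Finset.sum_le_sum_of_subset_of_nonneg (Finset.subset_univ _)
          fun _ _ _ => wordDensity_nonneg _ _ _
  rw [codeAvg, le_div_iff₀ (card_code_pos C), hcard]
  simp only [one_mul]
  refine le_trans (le_of_eq ?_) hsum
  field_simp

lemma integral_codeAvg_one (S : Finset (Fin n)) :
    ∫ y, codeAvg C S (fun _ => 1) y ∂wordBase ν n = 1 := by
  simp only [codeAvg, one_mul]
  rw [integral_div, integral_finsetSum _ fun c _ => (isBddMeas_wordDensity S _).integrable _]
  simp only [integral_wordDensity, Finset.sum_const, Finset.card_univ, nsmul_eq_mul, mul_one]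
  exact div_self (card_code_pos C).ne'

/-- Averaging over codewords hides at most d log 2 nats, d being the dimension of the restricted
code: by `codeAvg_one_ge` the logarithm of the mixture is at least that of each component minus d
log 2. -/
lemma le_blockInfo (P : Finset (Fin n)) :
    P.card * fairInfo ν - Module.finrank (ZMod 2) (codeRestrict C P) * Real.log 2 ≤
      blockInfo C ν P := by
  set d := Module.finrank (ZMod 2) (codeRestrict C P) with hd
  have hL := fun c : C => (isBddMeas_wordDensity P (c : Fin n → ZMod 2)).continuous_comp
    Real.continuous_mul_log
  have hf := isBddMeas_codeAvg C P fun _ => 1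
  have havg := (IsBddMeas.sum Finset.univ hL).mul (IsBddMeas.const ((Fintype.card C : ℝ)⁻¹))
  have hpt : ∀ y, (∑ c : C, wordDensity P c y * Real.log (wordDensity P c y)) *
      (Fintype.card C : ℝ)⁻¹ - d * Real.log 2 * codeAvg C P (fun _ => 1) y ≤
      codeAvg C P (fun _ => 1) y * Real.log (codeAvg C P (fun _ => 1) y) := by
    intro y
    have hterm : ∀ c : C, wordDensity P c y * Real.log (wordDensity P c y) -
        d * Real.log 2 * wordDensity P c y ≤
        wordDensity P c y * Real.log (codeAvg C P (fun _ => 1) y) := by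
      intro c
      rcases (wordDensity_nonneg P c y).eq_or_lt with h | h
      · simp [← h]
      · have hlog := Real.log_le_log (by positivity) (codeAvg_one_ge C P c y)
        rw [Real.log_div h.ne' (by positivity), Real.log_pow] at hlog
        have := mul_le_mul_of_nonneg_left hlog h.le
        linarith
    have hsum := Finset.sum_le_sum fun (c : C) (_ : c ∈ Finset.univ) => hterm c
    rw [Finset.sum_sub_distrib, ← Finset.mul_sum, ← Finset.sum_mul] at hsum
    have hscaled := mul_le_mul_of_nonneg_right hsum (inv_pos.mpr (card_code_pos C)).le
    have hdef : codeAvg C P (fun _ => 1) y =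
        (∑ c : C, wordDensity P c y) * (Fintype.card C : ℝ)⁻¹ := by
      simp [codeAvg, div_eq_mul_inv]
    -- The logarithm is made opaque so that `hdef` unfolds only the factor outside it.
    generalize Real.log (codeAvg C P (fun _ => 1) y) = l at hscaled ⊢
    rw [hdef]
    linarith
  have hmono := integral_mono ((havg.sub (hf.const_mul _)).integrable (wordBase ν n))
    ((hf.continuous_comp Real.continuous_mul_log).integrable (wordBase ν n)) hpt
  rw [integral_sub (havg.integrable _) ((hf.const_mul _).integrable _), integral_mul_const,
    integral_const_mul, integral_codeAvg_one,
    integral_finsetSum _ fun c _ => (hL c).integrable _] at hmono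
  simp only [integral_wordDensity_mul_log, Finset.sum_const, Finset.card_univ, nsmul_eq_mul,
    mul_one] at hmono
  rwa [mul_comm, inv_mul_cancel_left₀ (card_code_pos C).ne'] at hmono

end Codes

/-! ### The law of the output word under shifts and permutations. -/

section WordLaw

variable {n : ℕ} (ν : Measure Crossover) [IsProbabilityMeasure ν]

instance (c : Fin n → ZMod 2) : IsProbabilityMeasure (wordLaw ν c) := by
  unfold wordLaw; infer_instance

lemma wordLaw_eq_withDensity (c : Fin n → ZMod 2) : wordLaw ν c =
    (wordBase ν n).withDensity fun y => ENNReal.ofReal (wordDensity Finset.univ c y) := by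
  refine Measure.pi_eq fun s hs => ?_
  have hletter : ∀ j, outputLaw ν (c j) (s j) = ENNReal.ofReal
      (∫ z, (s j).indicator (fun z => 1 + bitSign (c j) * softBit z) z ∂baseLaw ν) := by
    intro j
    have hint : Integrable (fun z => 1 + bitSign (c j) * softBit z) (baseLaw ν) :=
      integrable_comp_letterDensity ν continuous_id (c j)
    rw [outputLaw_eq_withDensity, withDensity_apply _ (hs j), integral_indicator (hs j),
      ofReal_integral_eq_lintegral_ofReal hint.integrableOn
        (Eventually.of_forall fun z => letterDensity_nonneg _ _)]
  have hprod : ∀ y : Fin n → OutputLetter,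
      (Set.univ.pi s).indicator (wordDensity Finset.univ c) y =
        ∏ j, (s j).indicator (fun z => 1 + bitSign (c j) * softBit z) (y j) := by
    intro y
    by_cases hy : y ∈ Set.univ.pi s
    · rw [Set.indicator_of_mem hy, wordDensity]
      refine Finset.prod_congr rfl fun j _ => ?_
      rw [Set.indicator_of_mem (hy j (Set.mem_univ j))]
    · rw [Set.indicator_of_notMem hy]
      simp only [Set.mem_pi, Set.mem_univ, true_imp_iff, not_forall] at hy
      obtain ⟨j, hj⟩ := hy
      exact (Finset.prod_eq_zero (Finset.mem_univ j) (Set.indicator_of_notMem hj _)).symm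
  rw [withDensity_apply _ (MeasurableSet.univ_pi hs), ← ofReal_integral_eq_lintegral_ofReal
    ((isBddMeas_wordDensity _ c).integrable _).integrableOn
    (Eventually.of_forall fun y => wordDensity_nonneg _ _ _),
    ← integral_indicator (MeasurableSet.univ_pi hs)]
  simp_rw [hprod, hletter]
  rw [wordBase, integral_fintype_prod_eq_prod (𝕜 := ℝ)
    (f := fun j z => (s j).indicator (fun z => 1 + bitSign (c j) * softBit z) z),
    ENNReal.ofReal_prod_of_nonneg]
  exact fun j _ => integral_nonneg fun z =>
    Set.indicator_nonneg (fun z _ => letterDensity_nonneg _ _) z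

lemma integral_wordLaw (c : Fin n → ZMod 2) (F : (Fin n → OutputLetter) → ℝ) :
    ∫ y, F y ∂wordLaw ν c = ∫ y, F y * wordDensity Finset.univ c y ∂wordBase ν n := by
  rw [wordLaw_eq_withDensity, integral_withDensity_eq_integral_toReal_smul
    (isBddMeas_wordDensity _ c).1.ennreal_ofReal
    (Eventually.of_forall fun _ => ENNReal.ofReal_lt_top)]
  refine integral_congr_ae (Eventually.of_forall fun y => ?_)
  simp only [ENNReal.toReal_ofReal (wordDensity_nonneg _ _ _), smul_eq_mul, mul_comm]

lemma integral_wordLaw_eq_integral_comp_wordShift (a : Fin n → ZMod 2)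
    {F : (Fin n → OutputLetter) → ℝ} (hF : IsBddMeas F) :
    ∫ y, F y ∂wordLaw ν a = ∫ y, F (wordShift a y) ∂wordLaw ν 0 := by
  have haa : a + a = 0 := by
    ext j
    have : ∀ b : ZMod 2, b + b = 0 := by decide
    exact this _
  rw [integral_wordLaw, integral_wordLaw,
    ← integral_comp_wordShift ν a (hF.mul (isBddMeas_wordDensity _ a))]
  simp only [wordDensity_wordShift, haa]

lemma integral_comp_perm (σ : Equiv.Perm (Fin n)) {F : (Fin n → OutputLetter) → ℝ}
    (hF : IsBddMeas F) : ∫ y, F (y ∘ σ) ∂wordLaw ν 0 = ∫ y, F y ∂wordLaw ν 0 := by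
  have hm : Measurable fun y : Fin n → OutputLetter => y ∘ σ :=
    measurable_pi_lambda _ fun j => measurable_pi_apply (σ j)
  have hmap : (wordLaw ν (0 : Fin n → ZMod 2)).map (fun y => y ∘ σ) = wordLaw ν 0 := by
    symm
    refine Measure.pi_eq fun s hs => ?_
    have hpre : (fun y : Fin n → OutputLetter => y ∘ σ) ⁻¹' Set.univ.pi s =
        Set.univ.pi fun j => s (σ.symm j) := by
      ext y
      simp only [Set.mem_preimage, Set.mem_pi, Set.mem_univ, true_imp_iff, Function.comp]
      exact ⟨fun h j => by simpa using h (σ.symm j), fun h j => by simpa using h (σ j)⟩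
    rw [Measure.map_apply hm (MeasurableSet.univ_pi hs), hpre, wordLaw, Measure.pi_pi]
    exact Equiv.prod_comp σ.symm fun j => outputLaw ν 0 (s j)
  conv_rhs => rw [← hmap]
  rw [integral_map hm.aemeasurable hF.1.aestronglyMeasurable]

end WordLaw

/-! ### Symmetry of the code and the energy at each coordinate. -/

section Symmetry

open scoped Classical

variable {n : ℕ} (C : BinaryCode n) (ν : Measure Crossover) [IsProbabilityMeasure ν]

/-- Averaging over the transmitted codeword: a statistic `G b` that is equivariant under the
addition of codewords has the same mean for the zero codeword as for a uniformly drawn one. -/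
lemma integral_wordLaw_zero_eq_codeAvg {G : ZMod 2 → (Fin n → OutputLetter) → ℝ}
    (hG : ∀ b, IsBddMeas (G b)) {S : Finset (Fin n)}
    (hS : ∀ b, DependsOn (G b) (S : Set (Fin n))) {i : Fin n}
    (hequiv : ∀ (a : C) y, G (a.1 i) (wordShift a y) = G 0 y) :
    ∫ y, G 0 y ∂wordLaw ν 0 =
      ∫ y, (∑ c : C, G (c.1 i) y * wordDensity S c y) / Fintype.card C ∂wordBase ν n := by
  have h : ∀ c : C, ∫ y, G (c.1 i) y * wordDensity S c y ∂wordBase ν n =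
      ∫ y, G 0 y ∂wordLaw ν 0 := by
    intro c
    rw [← integral_mul_wordDensity_univ ν (hG _) (hS _), ← integral_wordLaw,
      integral_wordLaw_eq_integral_comp_wordShift ν _ (hG _)]
    simp only [hequiv]
  rw [integral_div, integral_finsetSum _ fun c _ =>
    ((hG _).mul (isBddMeas_wordDensity _ _)).integrable _]
  simp only [h, Finset.sum_const, Finset.card_univ, nsmul_eq_mul]
  rw [mul_div_cancel_left₀ _ (card_code_pos C).ne']

/-- Signed by the transmitted bit, the soft decision is invariant under codeword shifts, so its mean
at zero is its mean over uniform codewords: the correlation of (-1)^(X_i) with its conditional mean,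
that is, the energy. -/
lemma integral_softDecision (S : Finset (Fin n)) (i : Fin n) :
    ∫ y, softDecision C S i y ∂wordLaw ν 0 = decisionEnergy C ν S i := by
  have h := integral_wordLaw_zero_eq_codeAvg C ν (S := S) (i := i)
    (G := fun b y => bitSign b * softDecision C S i y)
    (fun b => (isBddMeas_softDecision C S i).const_mul _)
    (fun b y y' hy => by simp only [dependsOn_softDecision C S i hy])
    (fun a y => by
      rw [softDecision_wordShift, ← mul_assoc, bitSign_mul_self, bitSign_zero])
  simp only [bitSign_zero, one_mul] at h
  rw [h, decisionEnergy]
  refine integral_congr_ae (Eventually.of_forall fun y => ?_)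
  simp only [codeAvg]
  rw [← mul_div_assoc, Finset.mul_sum]
  congr 1
  exact Finset.sum_congr rfl fun c _ => by ring

lemma decisionEnergy_map {σ : Equiv.Perm (Fin n)} (hσ : IsCodeSymmetry C σ) (S : Finset (Fin n))
    (i : Fin n) :
    decisionEnergy C ν (S.map σ.toEmbedding) (σ i) = decisionEnergy C ν S i := by
  rw [← integral_softDecision, ← integral_softDecision,
    ← integral_comp_perm ν σ (isBddMeas_softDecision C S i)]
  simp only [softDecision_map C hσ]

variable {C} in
lemma IsCodeSymmetry.symm {σ : Equiv.Perm (Fin n)} (hσ : IsCodeSymmetry C σ) :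
    IsCodeSymmetry C σ.symm := fun x => by
  rw [← hσ (x ∘ σ.symm)]
  simp [Function.comp_assoc]

/-- On average over the petals through a coordinate, the other outputs on a petal have a
correlation with the bit that is bounded below by the gap to capacity. -/
lemma le_sum_decisionEnergy (htrans : ∀ i j : Fin n, ∃ σ, IsCodeSymmetry C σ ∧ σ i = j)
    {petals : Finset (Finset (Fin n))}
    (hinv : ∀ P ∈ petals, ∀ σ, IsCodeSymmetry C σ → P.map σ.toEmbedding ∈ petals) {γ : ℝ}
    (hrate : ∀ P ∈ petals, restrictRate C P ≤ capacity ν - γ) (i : Fin n) :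
    (petals.filter fun P => i ∈ P).card * (γ * Real.log 2) ≤
      ∑ P ∈ petals with i ∈ P, decisionEnergy C ν (P.erase i) i := by
  set e : Fin n → ℝ := fun i =>
    ∑ P ∈ petals with i ∈ P, (decisionEnergy C ν (P.erase i) i - γ * Real.log 2) with he
  have hlog : 0 < Real.log 2 := Real.log_pos (by norm_num)
  -- A symmetry moving `i` to `j` matches the petals through `i` with those through `j` and
  -- preserves energies.
  have hconst : ∀ j, e j = e i := by
    intro j
    obtain ⟨σ, hσ, rfl⟩ := htrans i j
    symm
    refine Finset.sum_nbij' (fun P => P.map σ.toEmbedding) (fun P => P.map σ.symm.toEmbedding)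
      ?_ ?_ ?_ ?_ ?_
    · intro P hP
      rw [Finset.mem_filter] at hP ⊢
      exact ⟨hinv P hP.1 σ hσ, Finset.mem_map_of_mem _ hP.2⟩
    · intro P hP
      rw [Finset.mem_filter] at hP ⊢
      exact ⟨hinv P hP.1 _ hσ.symm, by simpa using hP.2⟩
    · intro P _
      ext; simp
    · intro P _
      ext; simp
    · intro P _
      have : (P.map σ.toEmbedding).erase (σ i) = (P.erase i).map σ.toEmbedding :=
        (Finset.map_erase σ.toEmbedding P i).symm
      rw [this, decisionEnergy_map C ν hσ]
  have hpetal : ∀ P ∈ petals,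
      0 ≤ ∑ i ∈ P, (decisionEnergy C ν (P.erase i) i - γ * Real.log 2) := by
    intro P hP
    have h1 := (le_blockInfo C ν P).trans (blockInfo_le_sum_decisionEnergy C ν P)
    have h2 := capacity_mul_log_two_le ν
    have h3 := hrate P hP
    rw [Finset.sum_sub_distrib, Finset.sum_const, nsmul_eq_mul]
    rcases P.eq_empty_or_nonempty with rfl | hne
    · simp
    have hcard : (0 : ℝ) < P.card := by exact_mod_cast hne.card_pos
    rw [restrictRate, div_le_iff₀ hcard] at h3
    have h4 := mul_le_mul_of_nonneg_right h3 hlog.le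
    have h5 := mul_le_mul_of_nonneg_left h2 hcard.le
    linarith
  -- Double counting of pairs (coordinate, petal); each petal contributes a nonnegative excess.
  have htotal : 0 ≤ ∑ j, e j := by
    have hswap : ∑ j, e j =
        ∑ P ∈ petals, ∑ i ∈ P, (decisionEnergy C ν (P.erase i) i - γ * Real.log 2) := by
      refine Finset.sum_comm' fun j P => ?_
      simp [and_comm]
    rw [hswap]
    exact Finset.sum_nonneg hpetal
  simp only [hconst, Finset.sum_const, Finset.card_univ, nsmul_eq_mul, Fintype.card_fin] at htotal
  have hn : (0 : ℝ) < n := by exact_mod_cast (Nat.zero_le _).trans_lt i.2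
  have hei : 0 ≤ e i := nonneg_of_mul_nonneg_right htotal hn
  rw [he] at hei
  simp only [Finset.sum_sub_distrib, Finset.sum_const, nsmul_eq_mul] at hei
  linarith

/-! ### The vote of the petals. -/

/-- The sum of the soft decisions on bit `i` from the petals through `i`. -/
def petalVote (petals : Finset (Finset (Fin n))) (i : Fin n) (y : Fin n → OutputLetter) : ℝ :=
  ∑ P ∈ petals with i ∈ P, softDecision C (P.erase i) i y

lemma isBddMeas_petalVote (petals : Finset (Finset (Fin n))) (i : Fin n) :
    IsBddMeas (petalVote C petals i) :=
  IsBddMeas.sum _ fun P => isBddMeas_softDecision C (P.erase i) i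

lemma dependsOn_petalVote (petals : Finset (Finset (Fin n))) (i : Fin n) :
    DependsOn (petalVote C petals i) (({i}ᶜ : Finset (Fin n)) : Set (Fin n)) := fun y y' h =>
  Finset.sum_congr rfl fun P _ => dependsOn_softDecision C (P.erase i) i fun j hj =>
    h j (by simpa using Finset.ne_of_mem_erase (Finset.mem_coe.mp hj))

lemma petalVote_wordShift (petals : Finset (Finset (Fin n))) (i : Fin n) (a : C)
    (y : Fin n → OutputLetter) :
    petalVote C petals i (wordShift a y) = bitSign (a.1 i) * petalVote C petals i y := by
  simp only [petalVote, softDecision_wordShift, Finset.mul_sum]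

/-- By the second moment method, the vote of the petals rarely has the wrong sign. -/
lemma integral_petalVote_nonpos_le {δ ρ γ : ℝ} (hγ : 0 < γ) (hC : IsCamelliaCode C δ ρ)
    (hδ : δ ≤ capacity ν - codeRate C - γ) :
    ∃ petals : Finset (Finset (Fin n)), ∀ i,
      ∫ y, (if petalVote C petals i y ≤ 0 then 1 else 0) ∂wordLaw ν 0 ≤
        max ρ 0 / (γ * Real.log 2) ^ 2 := by
  obtain ⟨petals, hcover, hinv, hrate, hcorr⟩ := hC.petals
  refine ⟨petals, fun i => ?_⟩
  have hlog : 0 < γ * Real.log 2 := mul_pos hγ (Real.log_pos (by norm_num))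
  set A := petals.filter fun P => i ∈ P with hA
  have hd : (0 : ℝ) < A.card := by
    obtain ⟨P, hP, hi⟩ := hcover i
    exact_mod_cast Finset.card_pos.mpr ⟨P, Finset.mem_filter.mpr ⟨hP, hi⟩⟩
  have hmean : A.card * (γ * Real.log 2) ≤ ∫ y, petalVote C petals i y ∂wordLaw ν 0 := by
    have hsum : ∫ y, petalVote C petals i y ∂wordLaw ν 0 =
        ∑ P ∈ A, decisionEnergy C ν (P.erase i) i := by
      simp only [petalVote]
      rw [integral_finsetSum _ fun P _ => (isBddMeas_softDecision C (P.erase i) i).integrable _]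
      simp only [integral_softDecision, hA]
    rw [hsum]
    exact le_sum_decisionEnergy C ν hC.transitive hinv
      (fun P hP => (hrate P hP).trans (by linarith)) i
  -- The coordinate `i` is erased from every petal and counts zero. The maximum with 0 is needed
  -- since `ρ` may be negative when there is no pair i ≠ j.
  have hcount : ∀ j, ((A.filter fun P => j ∈ P.erase i).card : ℝ) ≤ max ρ 0 * A.card := by
    intro j
    rcases eq_or_ne i j with rfl | hij
    · simp only [Finset.mem_erase, ne_eq, not_true, false_and, Finset.filter_false,
        Finset.card_empty, Nat.cast_zero]
      positivity
    · have h := (hcorr i j hij).trans (le_max_left ρ 0)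
      rw [div_le_iff₀ hd] at h
      refine le_trans (le_of_eq ?_) h
      rw [hA, Finset.filter_filter]
      simp [Finset.mem_erase, hij.symm]
  have hvar := variance_sum_le (fun _ : Fin n => outputLaw ν 0) A
    (F := fun P => softDecision C (P.erase i) i) (fun P => isBddMeas_softDecision C (P.erase i) i)
    (fun P => P.erase i) (fun P => dependsOn_softDecision C (P.erase i) i) hcount
  change ∫ y, petalVote C petals i y ^ 2 ∂wordLaw ν 0 -
    (∫ y, petalVote C petals i y ∂wordLaw ν 0) ^ 2 ≤ _ * ∑ P ∈ A,
      (∫ y, softDecision C (P.erase i) i y ^ 2 ∂wordLaw ν 0 -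
        (∫ y, softDecision C (P.erase i) i y ∂wordLaw ν 0) ^ 2) at hvar
  have hvar1 : ∀ P ∈ A, ∫ y, softDecision C (P.erase i) i y ^ 2 ∂wordLaw ν 0 -
      (∫ y, softDecision C (P.erase i) i y ∂wordLaw ν 0) ^ 2 ≤ 1 := by
    intro P _
    have h1 := integral_mono (((isBddMeas_softDecision C (P.erase i) i).continuous_comp
      (continuous_pow 2)).integrable (wordLaw ν 0)) (integrable_const 1) fun y => by
        dsimp only
        rw [← sq_abs]
        exact pow_le_one₀ (abs_nonneg _) (abs_softDecision_le C (P.erase i) i y)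
    simp only [integral_const, probReal_univ, one_smul] at h1
    linarith [sq_nonneg (∫ y, softDecision C (P.erase i) i y ∂wordLaw ν 0)]
  have hvar2 := (Finset.sum_le_sum hvar1).trans_eq (by simp : ∑ P ∈ A, (1 : ℝ) = A.card)
  have hT := isBddMeas_petalVote C petals i
  set M := ∫ y, petalVote C petals i y ∂wordLaw ν 0 with hM
  have hMpos : 0 < M := lt_of_lt_of_le (mul_pos hd hlog) hmean
  have hind : IsBddMeas fun y => if petalVote C petals i y ≤ 0 then (1 : ℝ) else 0 :=
    ⟨Measurable.ite (measurableSet_le hT.1 measurable_const) measurable_const measurable_const, 1,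
      fun y => by dsimp only; split_ifs <;> simp⟩
  have hT2 := hT.continuous_comp (continuous_pow 2)
  -- Chebyshev's inequality: where the vote T is nonpositive, (T - M)² ≥ M², since M > 0.
  have hcheb := integral_mono ((hind.const_mul (M ^ 2)).integrable (wordLaw ν 0))
    (((hT2.sub (hT.const_mul (2 * M))).add (.const (M ^ 2))).integrable (wordLaw ν 0)) fun y => by
      dsimp only
      split_ifs with h
      · nlinarith
      · nlinarith [sq_nonneg (petalVote C petals i y - M)]
  rw [integral_const_mul, integral_add ((hT2.sub (hT.const_mul (2 * M))).integrable _)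
    (integrable_const _), integral_sub (hT2.integrable _) ((hT.const_mul _).integrable _),
    integral_const_mul, ← hM] at hcheb
  simp only [integral_const, probReal_univ, one_smul] at hcheb
  set I := ∫ y, (if petalVote C petals i y ≤ 0 then (1 : ℝ) else 0) ∂wordLaw ν 0 with hI
  have hI0 : 0 ≤ I := integral_nonneg fun y => by dsimp only; split_ifs <;> simp
  have hρ : 0 ≤ max ρ 0 * A.card := by positivity
  have h1 : M ^ 2 * I ≤ max ρ 0 * A.card * A.card := by
    have := mul_le_mul_of_nonneg_left hvar2 hρ
    nlinarith
  have h2 : (A.card * (γ * Real.log 2)) ^ 2 * I ≤ M ^ 2 * I :=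
    mul_le_mul_of_nonneg_right (pow_le_pow_left₀ (mul_pos hd hlog).le hmean 2) hI0
  rw [le_div_iff₀ (by positivity)]
  have h3 : (A.card : ℝ) ^ 2 * (I * (γ * Real.log 2) ^ 2) ≤ (A.card : ℝ) ^ 2 * max ρ 0 := by
    linarith
  exact le_of_mul_le_mul_left h3 (by positivity)

end Symmetry

/-! ### From the vote to maximum likelihood decoding. -/

section Decoding

open scoped Classical

variable {n : ℕ} (C : BinaryCode n)

/-- The indicator of the words with bit `b` at coordinate `i`. -/
def bitIndicator (i : Fin n) (b : ZMod 2) (c : Fin n → ZMod 2) : ℝ := if c i = b then 1 else 0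

lemma bitIndicator_add (i : Fin n) (b : ZMod 2) (c a : Fin n → ZMod 2) :
    bitIndicator i (a i + b) (c + a) = bitIndicator i b c := by
  simp only [bitIndicator, Pi.add_apply]
  congr 1
  rw [add_comm (c i), add_right_inj]

/-- The density of the outputs on `S` given that bit `i` of a uniformly drawn codeword is `b`. -/
def bitDensity (i : Fin n) (S : Finset (Fin n)) (b : ZMod 2) (y : Fin n → OutputLetter) : ℝ :=
  codeAvg C S (bitIndicator i b) y / codeAvg C ∅ (bitIndicator i b) y

lemma sum_filter_mem_code (φ : (Fin n → ZMod 2) → ℝ) (i : Fin n) (b : ZMod 2) :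
    ∑ x : Fin n → ZMod 2 with x ∈ C ∧ x i = b, φ x = ∑ c : C, bitIndicator i b c * φ c := by
  rw [← Finset.filter_filter, Finset.sum_filter]
  rw [Finset.sum_subtype (p := fun x => x ∈ C) (Finset.univ.filter fun x => x ∈ C) (by simp)]
  exact Finset.sum_congr rfl fun c _ => by simp [bitIndicator]

/-- Each flip probability is half a letter density. The number of codewords with the given bit
appears as an average over no outputs, where densities are 1, and the size of the code cancels. -/
lemma bitLikelihood_eq (i : Fin n) (S : Finset (Fin n)) (y : Fin n → OutputLetter) (b : ZMod 2) :
    bitLikelihood C i S (fun j => y j) b = (2⁻¹ : ℝ) ^ S.card * bitDensity C i S b y := by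
  have hprod : ∀ x : Fin n → ZMod 2,
      ∏ j : S, flipProb (y j).1 ((y j).2 - x j) = (2⁻¹ : ℝ) ^ S.card * wordDensity S x y := by
    intro x
    rw [Finset.prod_coe_sort S fun j => flipProb (y j).1 ((y j).2 - x j)]
    simp only [flipProb_sub, div_eq_mul_inv]
    rw [Finset.prod_mul_distrib, Finset.prod_const, mul_comm]
    rfl
  have hcard : ((Finset.univ.filter fun x : Fin n → ZMod 2 => x ∈ C ∧ x i = b).card : ℝ) =
      ∑ c : C, bitIndicator i b c * wordDensity ∅ c y := by
    rw [Finset.cast_card, sum_filter_mem_code]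
    simp [wordDensity]
  unfold bitLikelihood
  rw [hcard]
  simp only [hprod]
  rw [sum_filter_mem_code C (fun x => (2⁻¹ : ℝ) ^ S.card * wordDensity S x y), bitDensity, codeAvg,
    codeAvg, div_div_div_cancel_right₀ (card_code_pos C).ne', ← mul_div_assoc, Finset.mul_sum]
  congr 1
  exact Finset.sum_congr rfl fun c _ => by ring

lemma bitDensity_wordShift (i : Fin n) (S : Finset (Fin n)) (b : ZMod 2) (a : C)
    (y : Fin n → OutputLetter) :
    bitDensity C i S (a.1 i + b) (wordShift a y) = bitDensity C i S b y := by
  simp only [bitDensity, codeAvg_wordShift, bitIndicator_add]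

lemma measurable_bitDensity (i : Fin n) (S : Finset (Fin n)) (b : ZMod 2) :
    Measurable (bitDensity C i S b) :=
  (isBddMeas_codeAvg C S _).1.div (isBddMeas_codeAvg C ∅ _).1

lemma dependsOn_bitDensity (i : Fin n) (S : Finset (Fin n)) (b : ZMod 2) :
    DependsOn (bitDensity C i S b) (S : Set (Fin n)) := fun y y' h => by
  have h0 : codeAvg C ∅ (bitIndicator i b) y = codeAvg C ∅ (bitIndicator i b) y' :=
    dependsOn_codeAvg C ∅ _ (by simp)
  rw [bitDensity, bitDensity, dependsOn_codeAvg C S _ h, h0]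

lemma codeAvg_bitIndicator_nonneg (i : Fin n) (S : Finset (Fin n)) (b : ZMod 2)
    (y : Fin n → OutputLetter) : 0 ≤ codeAvg C S (bitIndicator i b) y := by
  refine div_nonneg (Finset.sum_nonneg fun c _ => mul_nonneg ?_ (wordDensity_nonneg _ _ _))
    (card_code_pos C).le
  unfold bitIndicator; split_ifs <;> simp

lemma codeAvg_empty_bitIndicator_zero_pos (i : Fin n) (y : Fin n → OutputLetter) :
    0 < codeAvg C ∅ (bitIndicator i 0) y := by
  refine div_pos (Finset.sum_pos' (fun c _ => mul_nonneg ?_ (wordDensity_nonneg _ _ _))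
    ⟨0, Finset.mem_univ _, ?_⟩) (card_code_pos C)
  · unfold bitIndicator; split_ifs <;> simp
  · simp [bitIndicator, wordDensity]

/-- Either the two values of a bit are equally likely in a linear code, or the bit is always
`0`. -/
lemma codeAvg_bitIndicator_one (i : Fin n) (S : Finset (Fin n)) (y : Fin n → OutputLetter) :
    codeAvg C S (bitIndicator i 1) y = 0 ∧ codeAvg C ∅ (bitIndicator i 1) y = 0 ∨
      codeAvg C ∅ (bitIndicator i 1) y = codeAvg C ∅ (bitIndicator i 0) y := by
  by_cases h : ∃ a : C, a.1 i = 1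
  · obtain ⟨a, ha⟩ := h
    right
    have hshift : codeAvg C ∅ (bitIndicator i 1) (wordShift a y) =
        codeAvg C ∅ (bitIndicator i 0) y := by
      have h1 : (1 : ZMod 2) = a.1 i + 0 := by rw [ha, add_zero]
      rw [codeAvg_wordShift, h1]
      simp only [bitIndicator_add]
    rw [← hshift]
    exact dependsOn_codeAvg C ∅ _ (by simp)
  · left
    push Not at h
    have h0 : ∀ c : C, bitIndicator i 1 c = 0 := fun c => if_neg (h c)
    simp [codeAvg, h0]

lemma sum_comp_bit_mul_wordDensity (i : Fin n) (S : Finset (Fin n)) (G : ZMod 2 → ℝ)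
    (y : Fin n → OutputLetter) :
    (∑ c : C, G (c.1 i) * wordDensity S c y) / Fintype.card C =
      codeAvg C S (bitIndicator i 0) y * G 0 + codeAvg C S (bitIndicator i 1) y * G 1 := by
  rw [codeAvg, codeAvg, div_mul_eq_mul_div, div_mul_eq_mul_div, ← add_div, Finset.sum_mul,
    Finset.sum_mul, ← Finset.sum_add_distrib]
  congr 1
  refine Finset.sum_congr rfl fun c _ => ?_
  rcases zmod_two_cases (c.1 i) with h | h <;> simp [bitIndicator, h, mul_comm]

variable {C} in
/-- The error probability of a maximum likelihood decoder is at most twice that of any decision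
by the sign of a statistic that changes its sign with the decoded bit. -/
lemma decodingError_le (ν : Measure Crossover) [IsProbabilityMeasure ν] {x : Fin n → ZMod 2}
    (hx : x ∈ C) {i : Fin n} {S : Finset (Fin n)} {D : BitDecoder S} (hD : IsMLDecoder C i S D)
    {T : (Fin n → OutputLetter) → ℝ} (hT : Measurable T) (hTS : DependsOn T (S : Set (Fin n)))
    (hshift : ∀ (a : C) y, T (wordShift a y) = bitSign (a.1 i) * T y) :
    decodingError ν x i S D ≤ 2 * ∫ y, (if T y ≤ 0 then 1 else 0) ∂wordLaw ν 0 := by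
  -- `B` counts every tie as an error, so it covers any tie-breaking and, unlike `D`, is equivariant
  -- under codeword shifts.
  set B : ZMod 2 → (Fin n → OutputLetter) → ℝ := fun b y =>
    if bitDensity C i S b y ≤ bitDensity C i S (b + 1) y then 1 else 0 with hB
  set F : ZMod 2 → (Fin n → OutputLetter) → ℝ := fun b y =>
    if bitSign b * T y ≤ 0 then 1 else 0 with hF
  have hBm : ∀ b, IsBddMeas (B b) := fun b =>
    ⟨Measurable.ite (measurableSet_le (measurable_bitDensity C i S b)
      (measurable_bitDensity C i S (b + 1))) measurable_const measurable_const, 1,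
      fun y => by simp only [hB]; split_ifs <;> simp⟩
  have hFm : ∀ b, IsBddMeas (F b) := fun b =>
    ⟨Measurable.ite (measurableSet_le (hT.const_mul _) measurable_const)
      measurable_const measurable_const, 1, fun y => by simp only [hF]; split_ifs <;> simp⟩
  have hBshift : ∀ (a : C) y, B (a.1 i) (wordShift a y) = B 0 y := by
    intro a y
    have h0 := bitDensity_wordShift C i S 0 a y
    rw [add_zero] at h0
    simp only [hB, h0, bitDensity_wordShift, zero_add]
  have hFshift : ∀ (a : C) y, F (a.1 i) (wordShift a y) = F 0 y := by
    intro a y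
    simp only [hF, hshift, ← mul_assoc, bitSign_mul_self, bitSign_zero]
  have herr : decodingError ν x i S D ≤ ∫ y, B (x i) y ∂wordLaw ν x := by
    have hmeas : MeasurableSet {y : Fin n → OutputLetter | D (fun j => y j) ≠ x i} :=
      (hD.measurable.comp (measurable_pi_lambda (fun (y : Fin n → OutputLetter) (j : S) => y j)
        fun j => measurable_pi_apply (j : Fin n)))
        (MeasurableSet.of_discrete (s := {b : ZMod 2 | b ≠ x i}))
    rw [decodingError, ← integral_indicator_one hmeas]
    refine integral_mono ((integrable_const 1).indicator hmeas) ((hBm _).integrable _) fun y => ?_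
    by_cases hy : D (fun j => y j) ≠ x i
    · have hne : ∀ p q : ZMod 2, p ≠ q → p = q + 1 := by decide
      have hmax := hD.maximal (fun j => y j) (x i)
      rw [hne _ _ hy, bitLikelihood_eq, bitLikelihood_eq] at hmax
      have hle := le_of_mul_le_mul_left hmax (by positivity)
      simp only [hB, if_pos hle]
      exact Set.indicator_le_self' (fun _ _ => zero_le_one) y
    · rw [Set.indicator_of_notMem (by simpa using hy)]
      simp only [hB]; split_ifs <;> simp
  have hpt : ∀ y, (∑ c : C, B (c.1 i) y * wordDensity S c y) / Fintype.card C ≤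
      2 * ((∑ c : C, F (c.1 i) y * wordDensity S c y) / Fintype.card C) := by
    intro y
    rw [sum_comp_bit_mul_wordDensity C i S (fun b => B b y),
      sum_comp_bit_mul_wordDensity C i S (fun b => F b y)]
    have h11 : (1 : ZMod 2) + 1 = 0 := by decide
    have hα := codeAvg_bitIndicator_nonneg C i S 0 y
    have hβ := codeAvg_bitIndicator_nonneg C i S 1 y
    have hp := codeAvg_empty_bitIndicator_zero_pos C i y
    simp only [hB, hF, bitSign_zero, bitSign_one, zero_add, h11, one_mul, neg_mul,
      Left.neg_nonpos_iff, bitDensity]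
    -- If the bit is always 0, the density of the value 1 is 0 / 0 = 0, and `B` can only hold where
    -- the output density vanishes.
    rcases codeAvg_bitIndicator_one C i S y with ⟨h1, h2⟩ | h1
    · rw [h1, h2, zero_div, zero_mul, zero_mul, add_zero, add_zero]
      have hrhs : 0 ≤ 2 * (codeAvg C S (bitIndicator i 0) y * if T y ≤ 0 then (1 : ℝ) else 0) :=
        mul_nonneg zero_le_two (mul_nonneg hα (by split_ifs <;> simp))
      split_ifs at hrhs ⊢ with h3
      all_goals first
        | linarith
        | (rw [div_le_iff₀ hp, zero_mul] at h3; linarith)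
    -- With α and β the joint weights of the two bit values, the left side is at most 2 min(α, β),
    -- doubled only at ties, while a sign decision errs with weight at least min(α, β).
    · simp only [h1, div_le_div_iff_of_pos_right hp]
      split_ifs <;> linarith
  have hBavg := integral_wordLaw_zero_eq_codeAvg C ν (S := S) (i := i) hBm
    (fun b y y' h => by simp only [hB, dependsOn_bitDensity C i S _ h]) hBshift
  have hFavg := integral_wordLaw_zero_eq_codeAvg C ν (S := S) (i := i) hFm
    (fun b y y' h => by simp only [hF, hTS h]) hFshift
  have hint : ∀ G : ZMod 2 → (Fin n → OutputLetter) → ℝ, (∀ b, IsBddMeas (G b)) →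
      Integrable (fun y => (∑ c : C, G (c.1 i) y * wordDensity S c y) / Fintype.card C)
        (wordBase ν n) := fun G hG =>
    ((IsBddMeas.sum Finset.univ fun c : C =>
      (hG (c.1 i)).mul (isBddMeas_wordDensity S c.1)).integrable _).div_const _
  calc decodingError ν x i S D ≤ ∫ y, B (x i) y ∂wordLaw ν x := herr
    _ = ∫ y, B 0 y ∂wordLaw ν 0 := by
        rw [integral_wordLaw_eq_integral_comp_wordShift ν x (hBm _)]
        exact integral_congr_ae (Eventually.of_forall fun y => hBshift ⟨x, hx⟩ y)
    _ ≤ 2 * ∫ y, F 0 y ∂wordLaw ν 0 := by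
        rw [hBavg, hFavg, ← integral_const_mul]
        exact integral_mono (hint B hBm) ((hint F hFm).const_mul 2) hpt
    _ = _ := by simp only [hF, bitSign_zero, one_mul]

variable {C} in
/-- Below capacity, the error probability of any maximum likelihood decoder of a bit of a camellia
code that sees at least the other outputs is linear in the correlation. -/
lemma IsCamelliaCode.decodingError_le {δ ρ γ : ℝ} (hC : IsCamelliaCode C δ ρ)
    (ν : Measure Crossover) [IsProbabilityMeasure ν] (hγ : 0 < γ)
    (hδ : δ ≤ capacity ν - codeRate C - γ) {x : Fin n → ZMod 2} (hx : x ∈ C) {i : Fin n}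
    {S : Finset (Fin n)} (hS : {i}ᶜ ⊆ S) {D : BitDecoder S} (hD : IsMLDecoder C i S D) :
    decodingError ν x i S D ≤ 2 / (γ * Real.log 2) ^ 2 * max ρ 0 := by
  obtain ⟨petals, hpetals⟩ := integral_petalVote_nonpos_le C ν hγ hC hδ
  have h := _root_.decodingError_le ν hx hD (isBddMeas_petalVote C petals i).1
    (fun y y' h => dependsOn_petalVote C petals i fun j hj => h j (hS hj))
    (petalVote_wordShift C petals i)
  calc _ ≤ _ := h
    _ ≤ 2 * (max ρ 0 / (γ * Real.log 2) ^ 2) := mul_le_mul_of_nonneg_left (hpetals i) zero_le_two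
    _ = _ := by ring

end Decoding

end

/-! ### Conclusion. -/

theorem theorem1 (ν : Measure Crossover) [IsProbabilityMeasure ν]
    (N : ℕ → ℕ) (C : ∀ k, BinaryCode (N k)) (δ ρ : ℕ → ℝ)
    (hC : ∀ k, IsCamelliaCode (C k) (δ k) (ρ k))
    (hδ : ∃ γ : ℝ, 0 < γ ∧ ∀ᶠ k in atTop, δ k ≤ capacity ν - codeRate (C k) - γ)
    (hρ : Tendsto ρ atTop (𝓝 0))
    (x : ∀ k, Fin (N k) → ZMod 2) (hx : ∀ k, x k ∈ C k)
    (Dloc : ∀ k (i : Fin (N k)), BitDecoder ({i}ᶜ : Finset (Fin (N k))))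
    (hDloc : ∀ k i, IsMLDecoder (C k) i {i}ᶜ (Dloc k i))
    (Dbit : ∀ k, Fin (N k) → BitDecoder (Finset.univ : Finset (Fin (N k))))
    (hDbit : ∀ k i, IsMLDecoder (C k) i Finset.univ (Dbit k i)) :
    (fun k => localError ν (x k) (Dloc k)) =O[atTop] (fun k => √(ρ k)) ∧
      Tendsto (fun k => localError ν (x k) (Dloc k)) atTop (𝓝 0) ∧
      Tendsto (fun k => bitError ν (x k) (Dbit k)) atTop (𝓝 0) := by
  obtain ⟨γ, hγ, hδ⟩ := hδ
  set K : ℝ := 2 / (γ * Real.log 2) ^ 2 with hK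
  have hK0 : 0 ≤ K := by positivity
  have hloc0 : ∀ k, 0 ≤ localError ν (x k) (Dloc k) := fun k =>
    Real.iSup_nonneg fun i => measureReal_nonneg
  have hbit0 : ∀ k, 0 ≤ bitError ν (x k) (Dbit k) := fun k =>
    Real.iSup_nonneg fun i => measureReal_nonneg
  have hloc : ∀ᶠ k in atTop, localError ν (x k) (Dloc k) ≤ K * max (ρ k) 0 := by
    filter_upwards [hδ] with k hk
    exact Real.iSup_le (fun i => (hC k).decodingError_le ν hγ hk (hx k) subset_rfl (hDloc k i))
      (mul_nonneg hK0 (le_max_right _ _))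
  have hbit : ∀ᶠ k in atTop, bitError ν (x k) (Dbit k) ≤ K * max (ρ k) 0 := by
    filter_upwards [hδ] with k hk
    exact Real.iSup_le
      (fun i => (hC k).decodingError_le ν hγ hk (hx k) (Finset.subset_univ _) (hDbit k i))
      (mul_nonneg hK0 (le_max_right _ _))
  have hlim : Tendsto (fun k => K * max (ρ k) 0) atTop (𝓝 0) := by
    simpa using (hρ.max (tendsto_const_nhds (x := (0 : ℝ)))).const_mul K
  refine ⟨IsBigO.of_bound K ?_,
    squeeze_zero' (Eventually.of_forall hloc0) hloc hlim,
    squeeze_zero' (Eventually.of_forall hbit0) hbit hlim⟩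
  -- Once `ρ k` ≤ 1, the linear bound is dominated by the square root; for negative `ρ k` both `max
  -- (ρ k) 0` and the root are 0.
  filter_upwards [hloc, hρ.eventually_le_const zero_lt_one] with k hk hk1
  rw [Real.norm_of_nonneg (hloc0 k), Real.norm_of_nonneg (Real.sqrt_nonneg _)]
  refine hk.trans (mul_le_mul_of_nonneg_left (max_le ?_ (Real.sqrt_nonneg _)) hK0)
  rcases le_total (ρ k) 0 with h | h
  · exact h.trans (Real.sqrt_nonneg _)
  · exact Real.le_sqrt_of_sq_le (by nlinarith)
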